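/- Let $X$ be a finite set and let $p(\cdot|t)$, $t\in K\subseteq\mathbb R$, be probability distributions on $X$. Let $\theta_1,\dots,\theta_n$ be interior points of $K$ such that $p(x|\theta_i)>0$ and $t\mapsto p(x|t)$ is differentiable at $\theta_i$ for all $x,i$, and let $w_i\ge0$, $\sum_i w_i=1$. For $m$ i.i.d. repetitions put $p(\vec x|t)=\prod_{r=1}^m p(x_r|t)$ and $g_j(\vec x)=\partial_\theta p(\vec x|\theta_j)$. For an estimator $\hat\theta_m:X^m\to\mathbb R$ let $$\mathcal C^{(i)}(m)_{jk}=\sum_{\vec x}\frac{g_j(\vec x)g_k(\vec x)}{p(\vec x|\theta_i)},\quad b^{(i)}_j=\sum_{\vec x}g_j(\vec x)\big[\hat\theta_m(\vec x)-\mathbb E_{\theta_i}\hat\theta_m\big],\quad \overline{\rm Var}(\hat\theta_m)=\sum_i w_i{\rm Var}_{\theta_i}(\hat\theta_m),$$ $$\mathcal B^{\rm FG}=\sum_i w_i\,b^{(i)\top}\mathcal C^{(i)}(m)^+b^{(i)},\qquad \mathcal B^{\rm GCR}=\sum_i w_i\frac{(b^{(i)}_i)^2}{\mathcal C^{(i)}(m)_{ii}},$$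 where $^+$ is the Moore–Penrose pseudoinverse and $0/0=0$. Write $b_j=b^{(j)}_j$, $F_i=\sum_x(\partial_\theta p(x|\theta_i))^2/p(x|\theta_i)$, and $u\sim v$ if $u-v=o(v)$ as $m\to\infty$. Then: 1. For every $m$ and every estimator, $\mathcal B^{\rm FG}$ (resp. $\mathcal B^{\rm GCR}$) is the supremum, over all (resp. all diagonal) real $n\times n$ matrices $A$ with columns $a_i$, of $\big(\sum_i w_ia_i^\top b^{(i)}\big)^2\big/\sum_i w_ia_i^\top\mathcal C^{(i)}(m)a_i$ (with $0/0=0$), and $\mathcal B^{\rm GCR}\le\mathcal B^{\rm FG}\le\overline{\rm Var}(\hat\theta_m)$. 2. If $P,Q$ are probability distributions on $X$ with $P(x)>0$ whenever $Q(x)>0$, then $\sum_x Q(x)^2/P(x)\ge1$ (terms with $P(x)=Q(x)=0$ being $0$), with equality if and only if $Q=P$. 3. Let $D_m$ be symmetric $k\times k$ matrices, $v_m\in\operatorname{Range}(D_m)$ and $c_m\in\mathbb R$, with $D_m^+\to0$, $(v_m)$ bounded and $|c_m|\ge\varepsilon$ for some $\varepsilon>0$ and all $m$. Then $\begin{pmatrix}D_m&v_m\\v_m^\top&c_m\end{pmatrix}^+-\begin{pmatrix}0&0\\0&1/c_m\end{pmatrix}\to0$.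 4. With $\Lambda_{jk}=\sum_x\frac{p(x|\theta_j)p(x|\theta_k)}{p(x|\theta_i)}$ and $R_{jk}=\sum_x\frac{p(x|\theta_k)\,\partial_\theta p(x|\theta_j)}{p(x|\theta_i)}$, for all $m,i,j,k$, $$\mathcal C^{(i)}(m)_{jk}=m(m-1)\Lambda_{jk}^{m-2}R_{jk}R_{kj}+m\Lambda_{jk}^{m-1}\mathcal C^{(i)}(1)_{jk},\qquad \mathcal C^{(i)}(1)_{jk}=\sum_x\frac{\partial_\theta p(x|\theta_j)\,\partial_\theta p(x|\theta_k)}{p(x|\theta_i)},$$ a term with factor $m$ or $m-1$ equal to $0$ being read as $0$. 5. If $p(\cdot|\theta_j)\ne p(\cdot|\theta_i)$ for all $j\ne i$, then $\big(\mathcal C^{(i)}(m)/m\big)^+$ converges as $m\to\infty$ to the matrix whose only nonzero entry is $1/\mathcal C^{(i)}(1)_{ii}$ in position $(i,i)$ (to $0$ if $\mathcal C^{(i)}(1)_{ii}=0$). 6. Suppose that, whenever $p(\cdot|\theta_j)=p(\cdot|\theta_i)$, the function $\partial_\theta p(\cdot|\theta_j)$ is a scalar multiple of $\partial_\theta p(\cdot|\theta_i)$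 (this holds in particular if the distributions $p(\cdot|\theta_i)$ are pairwise distinct). Let $(\hat\theta_m)_m$ be any sequence of estimators. If $b_j^2=O(\sum_i w_ib_i^2)$ for each $j$ with $w_j=0$ (no condition if all weights are positive), then $\mathcal B^{\rm FG}\sim\mathcal B^{\rm GCR}$. If all $b_j=O(1)$, then $m(\mathcal B^{\rm FG}-\mathcal B^{\rm GCR})\to0$. 7. Suppose that $K$ is compact, each $p(x|\cdot)$ is continuous on $K$ and $C^1$ near each $\theta_i$, $p(\cdot|t)\neq p(\cdot|\theta_i)$ for all $i$ and all $t\in K\setminus\{\theta_i\}$, and $F_i>0$ for all $i$. Then every sequence of maximum-likelihood estimators over $K$ saturates both bounds: $\overline{\rm Var}(\hat\theta_m)\sim\mathcal B^{\rm GCR}$, $\overline{\rm Var}(\hat\theta_m)\sim\mathcal B^{\rm FG}$, and $m\,\overline{\rm Var}(\hat\theta_m)\to\sum_i w_i/F_i$. 8. If $p(\cdot|\theta_i)\ne p(\cdot|\theta_j)$ whenever $\theta_i\neq\theta_j$, then for every sequence of maximum-likelihood estimators over the finite set $\{\theta_1,\dots,\theta_n\}$, $m(\overline{\rm Var}(\hat\theta_m)-\mathcal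 B^{\rm GCR})\to0$ and $m(\overline{\rm Var}(\hat\theta_m)-\mathcal B^{\rm FG})\to0$. -/

import Mathlib

open Filter Topology Asymptotics Matrix

/-- `B` is a Moore–Penrose pseudoinverse of the real matrix `A` (the four Penrose equations). -/
structure IsMoorePenrose {ι κ : Type*} [Fintype ι] [Fintype κ]
    (A : Matrix ι κ ℝ) (B : Matrix κ ι ℝ) : Prop where
  mul_mul_self : A * B * A = A
  self_mul_mul : B * A * B = B
  symm_left : (A * B)ᵀ = A * B
  symm_right : (B * A)ᵀ = B * A

theorem exists_isMoorePenrose_of_isSymm {ι : Type*} [Fintype ι] [DecidableEq ι]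
    (A : Matrix ι ι ℝ) (hA : Aᵀ = A) :
    ∃ B, IsMoorePenrose A B ∧ Bᵀ = B := by
  have hH : A.IsHermitian := by
    rw [Matrix.IsHermitian, Matrix.conjTranspose_eq_transpose_of_trivial, hA]
  obtain ⟨U, d, hU, hAU⟩ : ∃ (U : Matrix ι ι ℝ) (d : ι → ℝ), Uᵀ * U = 1 ∧
      A = U * Matrix.diagonal d * Uᵀ := by
    refine ⟨hH.eigenvectorUnitary, hH.eigenvalues, ?_, ?_⟩
    · have := Unitary.coe_star_mul_self hH.eigenvectorUnitary
      rwa [Matrix.star_eq_conjTranspose, Matrix.conjTranspose_eq_transpose_of_trivial] at this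
    · have := hH.spectral_theorem
      rw [Unitary.conjStarAlgAut_apply, Matrix.star_eq_conjTranspose,
        Matrix.conjTranspose_eq_transpose_of_trivial] at this
      exact this
  have key : ∀ e f : ι → ℝ, (U * Matrix.diagonal e * Uᵀ) * (U * Matrix.diagonal f * Uᵀ)
      = U * Matrix.diagonal (fun i => e i * f i) * Uᵀ := by
    intro e f
    calc _ = U * Matrix.diagonal e * (Uᵀ * U) * Matrix.diagonal f * Uᵀ := by
          simp only [Matrix.mul_assoc]
      _ = _ := by rw [hU, Matrix.mul_one, Matrix.mul_assoc U, Matrix.diagonal_mul_diagonal]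
  have hsymm : ∀ e : ι → ℝ, (U * Matrix.diagonal e * Uᵀ)ᵀ = U * Matrix.diagonal e * Uᵀ := by
    intro e
    simp [Matrix.transpose_mul, Matrix.mul_assoc]
  refine ⟨U * Matrix.diagonal (fun i => (d i)⁻¹) * Uᵀ, ⟨?_, ?_, ?_, ?_⟩, hsymm _⟩
  · rw [hAU, key, key]
    congr 3
    funext i
    exact mul_inv_mul_cancel (d i)
  · rw [hAU, key, key]
    congr 3
    funext i
    simpa using mul_inv_mul_cancel ((d i)⁻¹)
  · rw [hAU, key, hsymm]
  · rw [hAU, key, hsymm]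

theorem exists_isMoorePenrose {ι κ : Type*} [Fintype ι] [Fintype κ]
    (A : Matrix ι κ ℝ) : ∃ B, IsMoorePenrose A B := by
  classical
  obtain ⟨P, hP, hPs⟩ := exists_isMoorePenrose_of_isSymm (Aᵀ * A) (by simp)
  have h1 : A * (P * (Aᵀ * A)) = A := by
    have h0 : Aᵀ * A * (P * (Aᵀ * A) - 1) = 0 := by
      rw [Matrix.mul_sub, Matrix.mul_one, ← Matrix.mul_assoc, hP.mul_mul_self, sub_self]
    have h2 := (Matrix.conjTranspose_mul_self_mul_eq_zero A (P * (Aᵀ * A) - 1)).1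
      (by simpa [Matrix.conjTranspose_eq_transpose_of_trivial] using h0)
    rw [Matrix.mul_sub, Matrix.mul_one, sub_eq_zero] at h2
    exact h2
  refine ⟨P * Aᵀ, ⟨?_, ?_, ?_, ?_⟩⟩
  · simpa only [Matrix.mul_assoc] using h1
  · have := congrArg (· * Aᵀ) hP.self_mul_mul
    simpa only [Matrix.mul_assoc] using this
  · simp [Matrix.transpose_mul, hPs, Matrix.mul_assoc]
  · have := hP.symm_right
    simpa only [Matrix.mul_assoc] using this

theorem IsMoorePenrose.unique {ι κ : Type*} [Fintype ι] [Fintype κ]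
    {A : Matrix ι κ ℝ} {B C : Matrix κ ι ℝ}
    (hB : IsMoorePenrose A B) (hC : IsMoorePenrose A C) : B = C := by
  have e1 : A * B = A * C := by
    calc A * B = (A * C * A * B) := by rw [hC.mul_mul_self]
      _ = (A * C)ᵀ * (A * B)ᵀ := by rw [hC.symm_left, hB.symm_left, ← Matrix.mul_assoc]
      _ = (A * B * A * C)ᵀ := by rw [← Matrix.transpose_mul, ← Matrix.mul_assoc]
      _ = A * C := by rw [hB.mul_mul_self, hC.symm_left]
  have e2 : B * A = C * A := by
    calc B * A = B * (A * C * A) := by rw [hC.mul_mul_self]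
      _ = (B * A)ᵀ * (C * A)ᵀ := by rw [hC.symm_right, hB.symm_right]; simp only [Matrix.mul_assoc]
      _ = (C * (A * B * A))ᵀ := by
          rw [← Matrix.transpose_mul]; simp only [Matrix.mul_assoc]
      _ = C * A := by rw [hB.mul_mul_self, hC.symm_right]
  calc B = B * A * B := hB.self_mul_mul.symm
    _ = C * A * C := by rw [e2, Matrix.mul_assoc, e1, ← Matrix.mul_assoc]
    _ = C := hC.self_mul_mul

/-- The Moore–Penrose pseudoinverse of a real matrix. -/
noncomputable def pinv {ι κ : Type*} [Fintype ι] [Fintype κ] (A : Matrix ι κ ℝ) :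
    Matrix κ ι ℝ :=
  (exists_isMoorePenrose A).choose

/-! ### Global-score bounds for a finite family of distributions

`P i y` is the probability of the outcome `y` at the `i`-th parameter value, `g j` is the test
function attached to the `j`-th parameter value, `h` is an estimator and `w` are the weights. -/

/-- Expectation of `h` under the probability vector `P`. -/
def mean {Y : Type*} [Fintype Y] (P h : Y → ℝ) : ℝ := ∑ y, P y * h y

/-- Weighted variance `∑ i, w i * Var_i h`. -/
def weightedVar {n : ℕ} {Y : Type*} [Fintype Y] (w : Fin n → ℝ) (P : Fin n → Y → ℝ)
    (h : Y → ℝ) : ℝ :=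
  ∑ i, w i * ∑ y, P i y * (h y - mean (P i) h) ^ 2

/-- Information matrix `𝒞⁽ⁱ⁾`, with entries `∑ y, g j y * g k y / P i y`. -/
noncomputable def infoMatrix {n : ℕ} {Y : Type*} [Fintype Y] (P g : Fin n → Y → ℝ) (i : Fin n) :
    Matrix (Fin n) (Fin n) ℝ :=
  Matrix.of fun j k => ∑ y, g j y * g k y / P i y

/-- Bias vector `𝐛⁽ⁱ⁾`, with entries `∑ y, g j y * (h y - E_i h)`. -/
def biasVec {n : ℕ} {Y : Type*} [Fintype Y] (P g : Fin n → Y → ℝ) (h : Y → ℝ) (i : Fin n) :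
    Fin n → ℝ :=
  fun j => ∑ y, g j y * (h y - mean (P i) h)

/-- The global-score bound `ℬ(A)` of a hierarchy matrix `A`, whose `i`-th column is used at the
`i`-th parameter value. A vanishing denominator forces a vanishing numerator, and the value is
then `0`. -/
noncomputable def scoreBound {n : ℕ} {Y : Type*} [Fintype Y] (w : Fin n → ℝ)
    (P g : Fin n → Y → ℝ) (h : Y → ℝ) (A : Matrix (Fin n) (Fin n) ℝ) : ℝ :=
  (∑ i, w i * ((fun j => A j i) ⬝ᵥ biasVec P g h i)) ^ 2 /
    ∑ i, w i * ((fun j => A j i) ⬝ᵥ (infoMatrix P g i *ᵥ fun j => A j i))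

/-- The fully global bound `∑ i, w i * 𝐛⁽ⁱ⁾ᵀ (𝒞⁽ⁱ⁾)⁺ 𝐛⁽ⁱ⁾`. -/
noncomputable def fullyGlobalBound {n : ℕ} {Y : Type*} [Fintype Y] (w : Fin n → ℝ)
    (P g : Fin n → Y → ℝ) (h : Y → ℝ) : ℝ :=
  ∑ i, w i * (biasVec P g h i ⬝ᵥ (pinv (infoMatrix P g i) *ᵥ biasVec P g h i))

/-- The global Cramér–Rao bound `∑ i, w i * (b⁽ⁱ⁾_i)² / 𝒞⁽ⁱ⁾_ii`. When `𝒞⁽ⁱ⁾_ii = 0` the test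
function `g i` is zero, so `b⁽ⁱ⁾_i = 0`, and the term is `0`. -/
noncomputable def globalCRBound {n : ℕ} {Y : Type*} [Fintype Y] (w : Fin n → ℝ)
    (P g : Fin n → Y → ℝ) (h : Y → ℝ) : ℝ :=
  ∑ i, w i * (biasVec P g h i i ^ 2 / infoMatrix P g i i i)

/-! ### Independent repetitions of a one-parameter model `p x t = p(x|t)` -/

/-- Likelihood `∏ r, p(x_r|t)` of `m` independent repetitions. -/
def jointProb {X : Type*} (p : X → ℝ → ℝ) (m : ℕ) (x : Fin m → X) (t : ℝ) : ℝ :=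
  ∏ r, p (x r) t

/-- The distributions of `m` repetitions at the parameter values `θ i`. -/
def dist_m {n : ℕ} {X : Type*} (p : X → ℝ → ℝ) (θ : Fin n → ℝ) (m : ℕ) :
    Fin n → (Fin m → X) → ℝ :=
  fun i x => jointProb p m x (θ i)

/-- The local scores `∂_θ p(x_1, …, x_m|θ_j)`, used as test functions. -/
noncomputable def score_m {n : ℕ} {X : Type*} (p : X → ℝ → ℝ) (θ : Fin n → ℝ) (m : ℕ) :
    Fin n → (Fin m → X) → ℝ :=
  fun j x => deriv (jointProb p m x) (θ j)

/-- Information matrix `𝒞⁽ⁱ⁾(m)` of `m` repetitions with local scores. -/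
noncomputable def infoRep {n : ℕ} {X : Type*} [Fintype X] (p : X → ℝ → ℝ) (θ : Fin n → ℝ)
    (i : Fin n) (m : ℕ) : Matrix (Fin n) (Fin n) ℝ :=
  infoMatrix (dist_m p θ m) (score_m p θ m) i

/-- `Λ_jk = ∑ x, p(x|θ_j) p(x|θ_k) / p(x|θ_i)`. -/
noncomputable def lam {n : ℕ} {X : Type*} [Fintype X] (p : X → ℝ → ℝ) (θ : Fin n → ℝ)
    (i j k : Fin n) : ℝ :=
  ∑ x, p x (θ j) * p x (θ k) / p x (θ i)

/-- `R_jk = ∑ x, p(x|θ_k) ∂_θ p(x|θ_j) / p(x|θ_i)`. -/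
noncomputable def rCoef {n : ℕ} {X : Type*} [Fintype X] (p : X → ℝ → ℝ) (θ : Fin n → ℝ)
    (i j k : Fin n) : ℝ :=
  ∑ x, p x (θ k) * deriv (p x) (θ j) / p x (θ i)

/-- Classical Fisher information of a single outcome, `∑ x, (∂_θ p(x|t))² / p(x|t)`. -/
noncomputable def fisherInfo {X : Type*} [Fintype X] (p : X → ℝ → ℝ) (t : ℝ) : ℝ :=
  ∑ x, deriv (p x) t ^ 2 / p x t

/-- An estimator for each number `m` of repetitions. -/
abbrev EstimatorSeq (X : Type*) := (m : ℕ) → (Fin m → X) → ℝ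

/-- Weighted variance, fully global bound, global Cramér–Rao bound and the entries `b⁽ⁱ⁾_j` for
the `m`-th estimator of a sequence, with the local scores as test functions. -/
def varRep {n : ℕ} {X : Type*} [Fintype X] (w : Fin n → ℝ) (p : X → ℝ → ℝ) (θ : Fin n → ℝ)
    (est : EstimatorSeq X) (m : ℕ) : ℝ :=
  weightedVar w (dist_m p θ m) (est m)

noncomputable def fgRep {n : ℕ} {X : Type*} [Fintype X] (w : Fin n → ℝ) (p : X → ℝ → ℝ)
    (θ : Fin n → ℝ) (est : EstimatorSeq X) (m : ℕ) : ℝ :=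
  fullyGlobalBound w (dist_m p θ m) (score_m p θ m) (est m)

noncomputable def gcrRep {n : ℕ} {X : Type*} [Fintype X] (w : Fin n → ℝ) (p : X → ℝ → ℝ)
    (θ : Fin n → ℝ) (est : EstimatorSeq X) (m : ℕ) : ℝ :=
  globalCRBound w (dist_m p θ m) (score_m p θ m) (est m)

noncomputable def biasRep {n : ℕ} {X : Type*} [Fintype X] (p : X → ℝ → ℝ)
    (θ : Fin n → ℝ) (est : EstimatorSeq X) (i j : Fin n) (m : ℕ) : ℝ :=
  biasVec (dist_m p θ m) (score_m p θ m) (est m) i j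

/-- `est` is a maximum-likelihood estimator over the parameter set `S`: for all data it is a
maximizer of the likelihood over `S`. -/
def IsMLE {X : Type*} (p : X → ℝ → ℝ) (S : Set ℝ) (est : EstimatorSeq X) : Prop :=
  ∀ (m : ℕ) (x : Fin m → X),
    est m x ∈ S ∧ ∀ t ∈ S, jointProb p m x t ≤ jointProb p m x (est m x)

/-!
Both bounds are maxima of a quotient `(Σ wᵢ aᵢᵀbᵢ)² / Σ wᵢ aᵢᵀCᵢaᵢ`, attained at `aᵢ = Cᵢ⁺ bᵢ` by
the Cauchy–Schwarz inequality; a second application of it, to the covariance of the estimator with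
the scores, puts them below the variance.

In `L²(p(· | θᵢ))` the scores of `m` repetitions at parameters with distinct distributions become
orthogonal geometrically fast: the cosine of their angle is `O(m ρ ^ m)`, where `ρ < 1` is the
cosine of the angle between the two distributions themselves. So `C⁽ⁱ⁾(m) / m` dominates a multiple
close to one of a matrix that is decoupled along the groups of equal distributions. In the latter
every group but that of `θᵢ` carries a factor `Λ ^ (m - 1)` with `Λ = Σ p(x|θⱼ)² / p(x|θᵢ) > 1`.
Hence in the limit of the pseudoinverse only the group of `θᵢ` survives, and for collinear scores
this group yields exactly the `i`-th term of the diagonal bound.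

For maximum likelihood, the fourth moments of the empirical deviations show that the empirical
distribution is close to the true one off an event of probability `O(1 / m²)`. On the good event,
the likelihood of a parameter away from `θᵢ` is smaller than that of `θᵢ`, by a gap in the
Hellinger affinity that is uniform by compactness. Near `θᵢ` the likelihood equation is linear in
`t - θᵢ` with a coefficient converging to the Fisher information `Fᵢ`. The estimator is therefore
the mean of `θᵢ + score / Fᵢ` up to an error whose second moment is `o(1 / m)`, which determines
its variance and its covariance with the score. Over a finite parameter set it equals `θᵢ` on the
good event, so its variance is already `o(1 / m)`.
-/

/-! ### Pseudoinverses of symmetric matrices -/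

theorem isMoorePenrose_pinv {ι κ : Type*} [Fintype ι] [Fintype κ] (A : Matrix ι κ ℝ) :
    IsMoorePenrose A (pinv A) :=
  (exists_isMoorePenrose A).choose_spec

namespace IsMoorePenrose

variable {ι κ : Type*} [Fintype ι] [Fintype κ] {A : Matrix ι κ ℝ} {B : Matrix κ ι ℝ}

theorem pinv_eq (h : IsMoorePenrose A B) : pinv A = B :=
  (isMoorePenrose_pinv A).unique h

theorem transpose (h : IsMoorePenrose A B) : IsMoorePenrose Aᵀ Bᵀ where
  mul_mul_self := by simp only [← Matrix.transpose_mul, ← Matrix.mul_assoc, h.mul_mul_self]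
  self_mul_mul := by simp only [← Matrix.transpose_mul, ← Matrix.mul_assoc, h.self_mul_mul]
  symm_left := by rw [← Matrix.transpose_mul, h.symm_right, h.symm_right]
  symm_right := by rw [← Matrix.transpose_mul, h.symm_left, h.symm_left]

theorem smul (h : IsMoorePenrose A B) (r : ℝ) : IsMoorePenrose (r • A) (r⁻¹ • B) := by
  rcases eq_or_ne r 0 with rfl | hr
  · constructor <;> simp
  · constructor <;> simp [hr, h.mul_mul_self, h.self_mul_mul, h.symm_left, h.symm_right]

end IsMoorePenrose

theorem pinv_transpose {ι κ : Type*} [Fintype ι] [Fintype κ] (A : Matrix ι κ ℝ) :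
    pinv Aᵀ = (pinv A)ᵀ :=
  (isMoorePenrose_pinv A).transpose.pinv_eq

theorem pinv_smul {ι κ : Type*} [Fintype ι] [Fintype κ] (r : ℝ) (A : Matrix ι κ ℝ) :
    pinv (r • A) = r⁻¹ • pinv A :=
  ((isMoorePenrose_pinv A).smul r).pinv_eq

theorem pinv_zero {ι κ : Type*} [Fintype ι] [Fintype κ] : pinv (0 : Matrix ι κ ℝ) = 0 := by
  simpa using pinv_smul 0 (0 : Matrix ι κ ℝ)

theorem pinv_vecMulVec {ι κ : Type*} [Fintype ι] [Fintype κ] (u : ι → ℝ) (v : κ → ℝ) :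
    pinv (Matrix.vecMulVec u v) = ((u ⬝ᵥ u) * (v ⬝ᵥ v))⁻¹ • Matrix.vecMulVec v u := by
  rcases eq_or_ne u 0 with rfl | hu
  · simp [pinv_zero]
  rcases eq_or_ne v 0 with rfl | hv
  · have h : Matrix.vecMulVec u (0 : κ → ℝ) = 0 := by
      ext
      simp [Matrix.vecMulVec_apply]
    simp [h, pinv_zero]
  have hu' := dotProduct_self_eq_zero.not.2 hu
  have hv' := dotProduct_self_eq_zero.not.2 hv
  refine IsMoorePenrose.pinv_eq ⟨?_, ?_, ?_, ?_⟩ <;>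
    simp [Matrix.vecMulVec_mul_vecMulVec, smul_smul, Matrix.transpose_vecMulVec, mul_comm]
  · field_simp
    exact one_smul ℝ _
  · field_simp

theorem pinv_single {ι κ : Type*} [Fintype ι] [Fintype κ] [DecidableEq ι] [DecidableEq κ] (i : ι)
    (j : κ) (c : ℝ) : pinv (Matrix.single i j c) = Matrix.single j i c⁻¹ := by
  have h : Matrix.single i j c = c • Matrix.vecMulVec (Pi.single i 1) (Pi.single j 1) := by
    rw [← Matrix.single_eq_single_vecMulVec_single, Matrix.smul_single, smul_eq_mul, mul_one]
  rw [h, pinv_smul, pinv_vecMulVec, ← Matrix.single_eq_single_vecMulVec_single]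
  simp

section Symmetric

variable {ι : Type*} [Fintype ι] {C : Matrix ι ι ℝ}

theorem isSymm_pinv (hC : C.IsSymm) : (pinv C).IsSymm := by
  rw [Matrix.IsSymm, ← pinv_transpose, hC]

theorem mul_pinv_comm (hC : C.IsSymm) : C * pinv C = pinv C * C := by
  rw [← (isMoorePenrose_pinv C).symm_left, Matrix.transpose_mul, hC, isSymm_pinv hC]

theorem dotProduct_mulVec_comm (hC : C.IsSymm) (a b : ι → ℝ) :
    a ⬝ᵥ (C *ᵥ b) = (C *ᵥ a) ⬝ᵥ b := by
  rw [Matrix.dotProduct_mulVec, ← Matrix.mulVec_transpose, hC]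

theorem quadForm_pinv_mulVec (hC : C.IsSymm) (b : ι → ℝ) :
    (pinv C *ᵥ b) ⬝ᵥ (C *ᵥ (pinv C *ᵥ b)) = b ⬝ᵥ (pinv C *ᵥ b) := by
  rw [← dotProduct_mulVec_comm (isSymm_pinv hC), Matrix.mulVec_mulVec, Matrix.mulVec_mulVec,
    (isMoorePenrose_pinv C).self_mul_mul]

theorem mulVec_pinv_mulVec_mulVec (C : Matrix ι ι ℝ) (u : ι → ℝ) :
    C *ᵥ (pinv C *ᵥ (C *ᵥ u)) = C *ᵥ u := by
  rw [Matrix.mulVec_mulVec, Matrix.mulVec_mulVec, (isMoorePenrose_pinv C).mul_mul_self]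

theorem mulVec_sub_mulVec_pinv_mulVec (hC : C.IsSymm) (b : ι → ℝ) :
    C *ᵥ (b - C *ᵥ (pinv C *ᵥ b)) = 0 := by
  rw [Matrix.mulVec_sub, Matrix.mulVec_mulVec b, mul_pinv_comm hC, ← Matrix.mulVec_mulVec,
    mulVec_pinv_mulVec_mulVec, sub_self]

theorem mulVec_pinv_mulVec_of_orthogonal_ker (hC : C.IsSymm) {b : ι → ℝ}
    (hb : ∀ a, C *ᵥ a = 0 → a ⬝ᵥ b = 0) : C *ᵥ (pinv C *ᵥ b) = b := by
  have hker := mulVec_sub_mulVec_pinv_mulVec hC b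
  set e := b - C *ᵥ (pinv C *ᵥ b)
  have hself : e ⬝ᵥ e = 0 := by
    calc e ⬝ᵥ e = e ⬝ᵥ b - (C *ᵥ e) ⬝ᵥ (pinv C *ᵥ b) := by
          rw [← dotProduct_mulVec_comm hC, ← dotProduct_sub]
      _ = 0 := by rw [hb e hker, hker, zero_dotProduct, sub_zero]
  exact (sub_eq_zero.1 (dotProduct_self_eq_zero.1 hself)).symm

theorem pinv_mulVec_eq_zero_iff (hC : C.IsSymm) {x : ι → ℝ} :
    pinv C *ᵥ x = 0 ↔ C *ᵥ x = 0 := by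
  have hpinv := isMoorePenrose_pinv C
  constructor <;> intro hx
  · calc C *ᵥ x = (C * (pinv C * C)) *ᵥ x := by rw [← Matrix.mul_assoc, hpinv.mul_mul_self]
      _ = (C * C) *ᵥ (pinv C *ᵥ x) := by
          rw [← mul_pinv_comm hC, ← Matrix.mul_assoc, Matrix.mulVec_mulVec]
      _ = 0 := by rw [hx, Matrix.mulVec_zero]
  · calc pinv C *ᵥ x = (pinv C * (C * pinv C)) *ᵥ x := by
          rw [← Matrix.mul_assoc, hpinv.self_mul_mul]
      _ = (pinv C * pinv C) *ᵥ (C *ᵥ x) := by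
          rw [mul_pinv_comm hC, ← Matrix.mul_assoc, Matrix.mulVec_mulVec]
      _ = 0 := by rw [hx, Matrix.mulVec_zero]

end Symmetric

section PosSemidef

theorem isSymm_of_posSemidef {ι : Type*} {C : Matrix ι ι ℝ} (hC : C.PosSemidef) : C.IsSymm :=
  Matrix.isHermitian_iff_isSymm.1 hC.isHermitian

variable {ι : Type*} [Fintype ι] {A B C : Matrix ι ι ℝ}

theorem dotProduct_mulVec_self_nonneg (hC : C.PosSemidef) (a : ι → ℝ) :
    0 ≤ a ⬝ᵥ (C *ᵥ a) := by
  simpa using hC.dotProduct_mulVec_nonneg a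

theorem sq_dotProduct_mulVec_le (hC : C.PosSemidef) (a b : ι → ℝ) :
    (a ⬝ᵥ (C *ᵥ b)) ^ 2 ≤ (a ⬝ᵥ (C *ᵥ a)) * (b ⬝ᵥ (C *ᵥ b)) := by
  classical
  have hform := LinearMap.BilinForm.apply_sq_le_of_symm (Matrix.toBilin' C)
    (fun x => by
      simpa only [Matrix.toBilin'_apply'] using dotProduct_mulVec_self_nonneg hC x)
    ⟨fun x y => by
      simp only [Matrix.toBilin'_apply', RingHom.id_apply]
      rw [dotProduct_mulVec_comm (isSymm_of_posSemidef hC), dotProduct_comm]⟩ a b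
  simpa only [Matrix.toBilin'_apply'] using hform

theorem dotProduct_pinv_mulVec_nonneg (hC : C.PosSemidef) (b : ι → ℝ) :
    0 ≤ b ⬝ᵥ (pinv C *ᵥ b) := by
  rw [← quadForm_pinv_mulVec (isSymm_of_posSemidef hC)]
  exact dotProduct_mulVec_self_nonneg hC _

theorem sq_dotProduct_le_mul_pinv (hC : C.PosSemidef) {b : ι → ℝ}
    (hb : ∀ a, C *ᵥ a = 0 → a ⬝ᵥ b = 0) (a : ι → ℝ) :
    (a ⬝ᵥ b) ^ 2 ≤ (a ⬝ᵥ (C *ᵥ a)) * (b ⬝ᵥ (pinv C *ᵥ b)) := by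
  have hsymm := isSymm_of_posSemidef hC
  have hCS := sq_dotProduct_mulVec_le hC a (pinv C *ᵥ b)
  rwa [quadForm_pinv_mulVec hsymm, mulVec_pinv_mulVec_of_orthogonal_ker hsymm hb] at hCS

theorem dotProduct_pinv_le_of_sq_le (hC : C.PosSemidef) {b : ι → ℝ} {V : ℝ} (hV : 0 ≤ V)
    (hb : ∀ a, (a ⬝ᵥ b) ^ 2 ≤ (a ⬝ᵥ (C *ᵥ a)) * V) : b ⬝ᵥ (pinv C *ᵥ b) ≤ V := by
  have hoptimal := hb (pinv C *ᵥ b)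
  rw [quadForm_pinv_mulVec (isSymm_of_posSemidef hC), dotProduct_comm, sq] at hoptimal
  rcases (dotProduct_pinv_mulVec_nonneg hC b).eq_or_lt with h0 | h0
  · exact h0 ▸ hV
  · exact le_of_mul_le_mul_left hoptimal h0

/-- Antitonicity of the pseudoinverse, localized at `x`: the comparison of the quadratic forms is
needed only at the vector `B⁺ x`. -/
theorem dotProduct_pinv_le_dotProduct_pinv (hA : A.PosSemidef) (hB : B.PosSemidef)
    (hker : ∀ a, A *ᵥ a = 0 → B *ᵥ a = 0) {x : ι → ℝ}
    (hle : (pinv B *ᵥ x) ⬝ᵥ (A *ᵥ (pinv B *ᵥ x)) ≤ (pinv B *ᵥ x) ⬝ᵥ (B *ᵥ (pinv B *ᵥ x))) :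
    x ⬝ᵥ (pinv B *ᵥ x) ≤ x ⬝ᵥ (pinv A *ᵥ x) := by
  have hAsymm := isSymm_of_posSemidef hA
  have hBsymm := isSymm_of_posSemidef hB
  set a := pinv B *ᵥ x with ha
  rw [ha, quadForm_pinv_mulVec hBsymm, ← ha] at hle
  have hpair : a ⬝ᵥ (A *ᵥ (pinv A *ᵥ x)) = x ⬝ᵥ a := by
    have hres : pinv B *ᵥ (x - A *ᵥ (pinv A *ᵥ x)) = 0 :=
      (pinv_mulVec_eq_zero_iff hBsymm).2 (hker _ (mulVec_sub_mulVec_pinv_mulVec hAsymm x))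
    rw [Matrix.mulVec_sub, sub_eq_zero] at hres
    calc a ⬝ᵥ (A *ᵥ (pinv A *ᵥ x))
        = x ⬝ᵥ (pinv B *ᵥ (A *ᵥ (pinv A *ᵥ x))) := by
          rw [dotProduct_mulVec_comm (isSymm_pinv hBsymm)]
      _ = x ⬝ᵥ a := by rw [← hres]
  have hCS := sq_dotProduct_mulVec_le hA a (pinv A *ᵥ x)
  rw [hpair, quadForm_pinv_mulVec hAsymm, sq] at hCS
  rcases (dotProduct_pinv_mulVec_nonneg hB x).eq_or_lt with h0 | h0
  · exact h0 ▸ dotProduct_pinv_mulVec_nonneg hA x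
  · exact le_of_mul_le_mul_left
      (hCS.trans (mul_le_mul_of_nonneg_right hle (dotProduct_pinv_mulVec_nonneg hA x))) h0

end PosSemidef

section OrthogonalSum

variable {ι κ α : Type*} [Fintype ι] [Fintype κ] {s : Finset α}

theorem sum_mul_sum_of_mul_eq_zero {ι₁ ι₂ : Type*} {A : α → Matrix ι₁ κ ℝ}
    {B : α → Matrix κ ι₂ ℝ} (h : ∀ q ∈ s, ∀ q' ∈ s, q' ≠ q → A q * B q' = 0) :
    (∑ q ∈ s, A q) * ∑ q ∈ s, B q = ∑ q ∈ s, A q * B q := by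
  rw [Matrix.sum_mul]
  refine Finset.sum_congr rfl fun q hq => ?_
  rw [Matrix.mul_sum]
  exact Finset.sum_eq_single_of_mem q hq fun q' hq' => h q hq q' hq'

theorem IsMoorePenrose.sum {A : α → Matrix ι κ ℝ} {B : α → Matrix κ ι ℝ}
    (h : ∀ q ∈ s, IsMoorePenrose (A q) (B q))
    (hAB : ∀ q ∈ s, ∀ q' ∈ s, q' ≠ q → A q * B q' = 0)
    (hBA : ∀ q ∈ s, ∀ q' ∈ s, q' ≠ q → B q * A q' = 0) :
    IsMoorePenrose (∑ q ∈ s, A q) (∑ q ∈ s, B q) where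
  mul_mul_self := by
    rw [sum_mul_sum_of_mul_eq_zero hAB, sum_mul_sum_of_mul_eq_zero fun q hq q' hq' hne => by
      rw [Matrix.mul_assoc, hBA q hq q' hq' hne, Matrix.mul_zero]]
    exact Finset.sum_congr rfl fun q hq => (h q hq).mul_mul_self
  self_mul_mul := by
    rw [sum_mul_sum_of_mul_eq_zero hBA, sum_mul_sum_of_mul_eq_zero fun q hq q' hq' hne => by
      rw [Matrix.mul_assoc, hAB q hq q' hq' hne, Matrix.mul_zero]]
    exact Finset.sum_congr rfl fun q hq => (h q hq).self_mul_mul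
  symm_left := by
    rw [sum_mul_sum_of_mul_eq_zero hAB, Matrix.transpose_sum]
    exact Finset.sum_congr rfl fun q hq => (h q hq).symm_left
  symm_right := by
    rw [sum_mul_sum_of_mul_eq_zero hBA, Matrix.transpose_sum]
    exact Finset.sum_congr rfl fun q hq => (h q hq).symm_right

theorem mul_pinv_eq_zero {A B : Matrix ι ι ℝ} (hB : B.IsSymm) (h : A * B = 0) :
    A * pinv B = 0 := by
  rw [← (isMoorePenrose_pinv B).self_mul_mul, ← mul_pinv_comm hB, ← Matrix.mul_assoc,
    ← Matrix.mul_assoc, h, Matrix.zero_mul, Matrix.zero_mul]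

theorem pinv_mul_eq_zero {A B : Matrix ι ι ℝ} (hA : A.IsSymm) (h : A * B = 0) :
    pinv A * B = 0 := by
  rw [← (isMoorePenrose_pinv A).self_mul_mul, Matrix.mul_assoc (pinv A), mul_pinv_comm hA,
    Matrix.mul_assoc, Matrix.mul_assoc, h, Matrix.mul_zero, Matrix.mul_zero]

theorem pinv_sum_of_mul_eq_zero {A : α → Matrix ι ι ℝ} (hA : ∀ q ∈ s, (A q).IsSymm)
    (h : ∀ q ∈ s, ∀ q' ∈ s, q' ≠ q → A q * A q' = 0) :
    pinv (∑ q ∈ s, A q) = ∑ q ∈ s, pinv (A q) :=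
  (IsMoorePenrose.sum (fun q _ => isMoorePenrose_pinv (A q))
    (fun q hq q' hq' hne => mul_pinv_eq_zero (hA q' hq') (h q hq q' hq' hne))
    fun q hq q' hq' hne => pinv_mul_eq_zero (hA q hq) (h q hq q' hq' hne)).pinv_eq

end OrthogonalSum

section Convergence

variable {ι α : Type*} [Fintype ι] {l : Filter α}

theorem tendsto_matrix_of_tendsto_dotProduct {M : α → Matrix ι ι ℝ} {N : Matrix ι ι ℝ}
    (hM : ∀ a, (M a).IsSymm) (hN : N.IsSymm)
    (h : ∀ x, Tendsto (fun a => x ⬝ᵥ (M a *ᵥ x)) l (𝓝 (x ⬝ᵥ (N *ᵥ x)))) :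
    Tendsto M l (𝓝 N) := by
  classical
  have hpolar : ∀ (C : Matrix ι ι ℝ), C.IsSymm → ∀ j k, C j k =
      ((Pi.single j 1 + Pi.single k 1) ⬝ᵥ (C *ᵥ (Pi.single j 1 + Pi.single k 1)) -
        Pi.single j 1 ⬝ᵥ (C *ᵥ Pi.single j 1) - Pi.single k 1 ⬝ᵥ (C *ᵥ Pi.single k 1)) / 2 := by
    intro C hC j k
    have hjk : C k j = C j k := hC.apply j k
    simp only [Matrix.mulVec_add, add_dotProduct, dotProduct_add, single_dotProduct,
      Matrix.mulVec_single_one, Matrix.col_apply, one_mul]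
    linarith
  refine tendsto_pi_nhds.2 fun j => tendsto_pi_nhds.2 fun k => ?_
  rw [hpolar N hN j k]
  simp only [hpolar _ (hM _) j k]
  exact (((h _).sub (h _)).sub (h _)).div_const 2

end Convergence

/-! ### The bounds as optimal values -/

section Bounds

variable {n : ℕ} {Y : Type*} [Fintype Y] {w : Fin n → ℝ} {P : Fin n → Y → ℝ}
  (g : Fin n → Y → ℝ) (h : Y → ℝ)

theorem infoMatrix_isSymm (P : Fin n → Y → ℝ) (i : Fin n) : (infoMatrix P g i).IsSymm := by
  ext j k
  simp [infoMatrix, mul_comm]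

theorem infoMatrix_self (P : Fin n → Y → ℝ) (i : Fin n) :
    infoMatrix P g i i i = ∑ y, g i y ^ 2 / P i y := by
  simp only [infoMatrix, Matrix.of_apply, sq]

theorem dotProduct_infoMatrix (P : Fin n → Y → ℝ) (i : Fin n) (a c : Fin n → ℝ) :
    a ⬝ᵥ (infoMatrix P g i *ᵥ c) =
      ∑ y, (∑ j, a j * g j y) * (∑ k, c k * g k y) / P i y := by
  simp only [dotProduct, Matrix.mulVec, infoMatrix, Matrix.of_apply, Finset.mul_sum,
    Finset.sum_mul, Finset.sum_div]
  rw [Finset.sum_comm]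
  conv_rhs => rw [Finset.sum_comm]
  refine Finset.sum_congr rfl fun k _ => ?_
  rw [Finset.sum_comm]
  exact Finset.sum_congr rfl fun y _ => Finset.sum_congr rfl fun j _ => by ring

theorem quadForm_infoMatrix (P : Fin n → Y → ℝ) (i : Fin n) (a : Fin n → ℝ) :
    a ⬝ᵥ (infoMatrix P g i *ᵥ a) = ∑ y, (∑ j, a j * g j y) ^ 2 / P i y := by
  simp only [dotProduct_infoMatrix, sq]

theorem dotProduct_sum_mul (f : Y → ℝ) (a : Fin n → ℝ) :
    (a ⬝ᵥ fun j => ∑ y, g j y * f y) = ∑ y, (∑ j, a j * g j y) * f y := by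
  simp only [dotProduct, Finset.mul_sum, Finset.sum_mul]
  rw [Finset.sum_comm]
  exact Finset.sum_congr rfl fun y _ => Finset.sum_congr rfl fun j _ => by ring

variable {i : Fin n}

theorem infoMatrix_posSemidef (hP : ∀ y, 0 < P i y) : (infoMatrix P g i).PosSemidef := by
  refine .of_dotProduct_mulVec_nonneg
    (Matrix.isHermitian_iff_isSymm.2 (infoMatrix_isSymm g P i)) fun a => ?_
  rw [star_trivial, quadForm_infoMatrix]
  exact Finset.sum_nonneg fun y _ => div_nonneg (sq_nonneg _) (hP y).le

theorem infoMatrix_mulVec_eq_zero_iff (hP : ∀ y, 0 < P i y) {a : Fin n → ℝ} :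
    infoMatrix P g i *ᵥ a = 0 ↔ ∀ y, ∑ j, a j * g j y = 0 := by
  rw [← (infoMatrix_posSemidef g hP).dotProduct_mulVec_zero_iff, star_trivial,
    quadForm_infoMatrix,
    Finset.sum_eq_zero_iff_of_nonneg fun y _ => div_nonneg (sq_nonneg _) (hP y).le]
  simp [(hP _).ne']

theorem dotProduct_sum_mul_eq_zero (hP : ∀ y, 0 < P i y) (f : Y → ℝ) {a : Fin n → ℝ}
    (ha : infoMatrix P g i *ᵥ a = 0) : (a ⬝ᵥ fun j => ∑ y, g j y * f y) = 0 := by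
  rw [dotProduct_sum_mul]
  exact Finset.sum_eq_zero fun y _ => by
    rw [(infoMatrix_mulVec_eq_zero_iff g hP).1 ha, zero_mul]

theorem eq_zero_of_infoMatrix_self_eq_zero (hP : ∀ y, 0 < P i y) (hC : infoMatrix P g i i i = 0)
    (y : Y) : g i y = 0 := by
  rw [infoMatrix_self, Finset.sum_eq_zero_iff_of_nonneg
    fun y _ => div_nonneg (sq_nonneg _) (hP y).le] at hC
  simpa [(hP y).ne'] using hC y (Finset.mem_univ y)

theorem isLUB_sq_sum_div_sum {α ι : Type*} [Fintype ι] {w : ι → ℝ} (hw : ∀ i, 0 ≤ w i)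
    (s q : α → ι → ℝ) {N : ι → ℝ} (hN : ∀ i, 0 ≤ N i) (hq : ∀ a i, 0 ≤ q a i)
    (hle : ∀ a i, s a i ^ 2 ≤ q a i * N i) (a₀ : α) (hs₀ : ∀ i, s a₀ i = N i)
    (hq₀ : ∀ i, q a₀ i = N i) :
    IsLUB (Set.range fun a => (∑ i, w i * s a i) ^ 2 / ∑ i, w i * q a i) (∑ i, w i * N i) := by
  have hN' : 0 ≤ ∑ i, w i * N i := Finset.sum_nonneg fun i _ => mul_nonneg (hw i) (hN i)
  refine ⟨?_, fun u hu => ?_⟩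
  · rintro _ ⟨a, rfl⟩
    refine div_le_of_le_mul₀ (Finset.sum_nonneg fun i _ => mul_nonneg (hw i) (hq a i)) hN' ?_
    rw [mul_comm]
    refine Finset.sum_sq_le_sum_mul_sum_of_sq_le_mul _
      (fun i _ => mul_nonneg (hw i) (hq a i)) (fun i _ => mul_nonneg (hw i) (hN i)) fun i _ => ?_
    calc (w i * s a i) ^ 2 = w i ^ 2 * s a i ^ 2 := by ring
      _ ≤ w i ^ 2 * (q a i * N i) := mul_le_mul_of_nonneg_left (hle a i) (sq_nonneg _)
      _ = w i * q a i * (w i * N i) := by ring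
  · have hbound := hu ⟨a₀, rfl⟩
    simp only [hs₀, hq₀, sq] at hbound
    rcases hN'.eq_or_lt with h0 | h0
    · simpa [← h0] using hbound
    · rwa [mul_div_assoc, div_self h0.ne', mul_one] at hbound

theorem isLUB_fullyGlobalBound (hw : ∀ i, 0 ≤ w i) (hP : ∀ i y, 0 < P i y) :
    IsLUB (Set.range fun A : Matrix (Fin n) (Fin n) ℝ => scoreBound w P g h A)
      (fullyGlobalBound w P g h) :=
  isLUB_sq_sum_div_sum hw
    (fun (A : Matrix (Fin n) (Fin n) ℝ) i => (fun j => A j i) ⬝ᵥ biasVec P g h i)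
    (fun A i => (fun j => A j i) ⬝ᵥ (infoMatrix P g i *ᵥ fun j => A j i))
    (fun i => dotProduct_pinv_mulVec_nonneg (infoMatrix_posSemidef g (hP i)) _)
    (fun _ i => dotProduct_mulVec_self_nonneg (infoMatrix_posSemidef g (hP i)) _)
    (fun _ i => sq_dotProduct_le_mul_pinv (infoMatrix_posSemidef g (hP i))
      (fun _ ha => dotProduct_sum_mul_eq_zero g (hP i) _ ha) _)
    (fun j i => (pinv (infoMatrix P g i) *ᵥ biasVec P g h i) j)
    (fun _ => dotProduct_comm _ _)
    (fun i => quadForm_pinv_mulVec (infoMatrix_isSymm g P i) _)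

theorem scoreBound_diagonal (w : Fin n → ℝ) (P : Fin n → Y → ℝ) (a : Fin n → ℝ) :
    scoreBound w P g h (Matrix.diagonal a) =
      (∑ i, w i * (a i * biasVec P g h i i)) ^ 2 /
        ∑ i, w i * (a i ^ 2 * infoMatrix P g i i i) := by
  have hcol : ∀ i, (fun j => Matrix.diagonal a j i) = Pi.single i (a i) := fun i => by
    ext j
    rcases eq_or_ne j i with rfl | hj <;> simp [*]
  simp only [scoreBound, hcol, single_dotProduct, Matrix.mulVec_single, Pi.smul_apply,
    Matrix.col_apply, MulOpposite.smul_eq_mul_unop, MulOpposite.unop_op]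
  simp only [sq, mul_comm, mul_left_comm]

theorem isLUB_globalCRBound (hw : ∀ i, 0 ≤ w i) (hP : ∀ i y, 0 < P i y) :
    IsLUB (Set.range fun a : Fin n → ℝ => scoreBound w P g h (Matrix.diagonal a))
      (globalCRBound w P g h) := by
  have hC : ∀ i, 0 ≤ infoMatrix P g i i i := fun i => (infoMatrix_posSemidef g (hP i)).diag_nonneg
  have hbias : ∀ i, infoMatrix P g i i i = 0 → biasVec P g h i i = 0 := fun i h0 =>
    Finset.sum_eq_zero fun y _ => by
      rw [eq_zero_of_infoMatrix_self_eq_zero g (hP i) h0, zero_mul]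
  simp only [scoreBound_diagonal]
  refine isLUB_sq_sum_div_sum hw (fun (a : Fin n → ℝ) i => a i * biasVec P g h i i)
    (fun a i => a i ^ 2 * infoMatrix P g i i i)
    (fun i => div_nonneg (sq_nonneg _) (hC i)) (fun a i => mul_nonneg (sq_nonneg _) (hC i)) ?_
    (fun i => biasVec P g h i i / infoMatrix P g i i i) ?_ ?_
  · intro a i
    by_cases h0 : infoMatrix P g i i i = 0
    · simp [hbias i h0]
    · exact le_of_eq (by field_simp)
  · intro i
    ring
  · intro i
    by_cases h0 : infoMatrix P g i i i = 0
    · simp [h0]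
    · field_simp

theorem globalCRBound_nonneg (hw : ∀ i, 0 ≤ w i) (hP : ∀ i y, 0 < P i y) :
    0 ≤ globalCRBound w P g h :=
  Finset.sum_nonneg fun i _ => mul_nonneg (hw i) <| div_nonneg (sq_nonneg _)
    (infoMatrix_posSemidef g (hP i)).diag_nonneg

theorem globalCRBound_le_fullyGlobalBound (hw : ∀ i, 0 ≤ w i) (hP : ∀ i y, 0 < P i y) :
    globalCRBound w P g h ≤ fullyGlobalBound w P g h :=
  (isLUB_globalCRBound g h hw hP).2 <| by
    rintro _ ⟨a, rfl⟩
    exact (isLUB_fullyGlobalBound g h hw hP).1 ⟨_, rfl⟩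

theorem fullyGlobalBound_le_weightedVar (hw : ∀ i, 0 ≤ w i) (hP : ∀ i y, 0 < P i y) :
    fullyGlobalBound w P g h ≤ weightedVar w P h := by
  refine Finset.sum_le_sum fun i _ => mul_le_mul_of_nonneg_left ?_ (hw i)
  refine dotProduct_pinv_le_of_sq_le (infoMatrix_posSemidef g (hP i))
    (Finset.sum_nonneg fun y _ => mul_nonneg (hP i y).le (sq_nonneg _)) fun a => ?_
  rw [quadForm_infoMatrix]
  refine (congrArg (· ^ 2) (dotProduct_sum_mul g _ a)).trans_le ?_
  refine Finset.sum_sq_le_sum_mul_sum_of_sq_le_mul _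
    (fun y _ => div_nonneg (sq_nonneg _) (hP i y).le)
    (fun y _ => mul_nonneg (hP i y).le (sq_nonneg _)) fun y _ => le_of_eq ?_
  have := (hP i y).ne'
  field_simp

end Bounds

section ChiSquare

variable {X : Type*} [Fintype X] {P Q : X → ℝ}

theorem sum_sq_div_eq_one_add (hP1 : ∑ x, P x = 1) (hQ1 : ∑ x, Q x = 1)
    (hPQ : ∀ x, P x = 0 → Q x = 0) :
    ∑ x, Q x ^ 2 / P x = 1 + ∑ x, (Q x - P x) ^ 2 / P x := by
  have hterm : ∀ x, Q x ^ 2 / P x = (2 * Q x - P x) + (Q x - P x) ^ 2 / P x := fun x => by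
    by_cases hx : P x = 0
    · simp [hx, hPQ x hx]
    · field_simp
      ring
  simp only [hterm, Finset.sum_add_distrib, Finset.sum_sub_distrib, ← Finset.mul_sum, hP1, hQ1]
  norm_num

theorem one_le_sum_sq_div (hP : ∀ x, 0 ≤ P x) (hP1 : ∑ x, P x = 1) (hQ1 : ∑ x, Q x = 1)
    (hPQ : ∀ x, P x = 0 → Q x = 0) : 1 ≤ ∑ x, Q x ^ 2 / P x := by
  rw [sum_sq_div_eq_one_add hP1 hQ1 hPQ, le_add_iff_nonneg_right]
  exact Finset.sum_nonneg fun x _ => div_nonneg (sq_nonneg _) (hP x)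

theorem sum_sq_div_eq_one_iff (hP : ∀ x, 0 ≤ P x) (hP1 : ∑ x, P x = 1) (hQ1 : ∑ x, Q x = 1)
    (hPQ : ∀ x, P x = 0 → Q x = 0) : ∑ x, Q x ^ 2 / P x = 1 ↔ Q = P := by
  rw [sum_sq_div_eq_one_add hP1 hQ1 hPQ, add_eq_left,
    Finset.sum_eq_zero_iff_of_nonneg fun x _ => div_nonneg (sq_nonneg _) (hP x), funext_iff]
  refine ⟨fun h x => ?_, fun h x _ => by simp [h x]⟩
  by_cases hx : P x = 0
  · rw [hx, hPQ x hx]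
  · simpa [hx, sub_eq_zero] using h x (Finset.mem_univ x)

end ChiSquare

/-! ### Pseudoinverses of bordered matrices -/

theorem isMoorePenrose_fromBlocks {ι κ : Type*} [Fintype ι] [Fintype κ] [DecidableEq κ]
    {D : Matrix ι ι ℝ} {V y : Matrix ι κ ℝ} {c S : Matrix κ κ ℝ} (hD : D.IsSymm) (hc : c.IsSymm)
    (hy : pinv D * V = y) (hV : D * y = V) (hS : c - Vᵀ * y = S) (hdet : IsUnit S.det) :
    IsMoorePenrose (fromBlocks D V Vᵀ c)
      (fromBlocks (pinv D + y * S⁻¹ * yᵀ) (-(y * S⁻¹)) (-(S⁻¹ * yᵀ)) S⁻¹) := by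
  have hE := isSymm_pinv hD
  have hpinv := isMoorePenrose_pinv D
  have hyT : Vᵀ * pinv D = yᵀ := by rw [← hy, Matrix.transpose_mul, hE]
  have hVy : Vᵀ * y = c - S := by rw [← hS, sub_sub_cancel]
  have hS_symm : Sᵀ = S := by
    rw [← hS, Matrix.transpose_sub, hc, Matrix.transpose_mul, Matrix.transpose_transpose, ← hyT,
      Matrix.mul_assoc, hy]
  have hS_inv_symm : (S⁻¹)ᵀ = S⁻¹ := by rw [Matrix.transpose_nonsing_inv, hS_symm]
  set M := fromBlocks D V Vᵀ c with hM
  set B := fromBlocks (pinv D + y * S⁻¹ * yᵀ) (-(y * S⁻¹)) (-(S⁻¹ * yᵀ)) S⁻¹ with hB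
  have hMB : M * B = fromBlocks (D * pinv D) 0 0 1 := by
    rw [hM, hB, fromBlocks_multiply]
    congr 1
    · simp [Matrix.mul_add, ← Matrix.mul_assoc, hV]
    · simp [← Matrix.mul_assoc, hV]
    · simp [Matrix.mul_add, ← Matrix.mul_assoc, hyT, hVy, Matrix.sub_mul,
        Matrix.mul_nonsing_inv _ hdet]
    · simp [← Matrix.mul_assoc, hVy, Matrix.sub_mul, Matrix.mul_nonsing_inv _ hdet]
  have hMBT : (M * B)ᵀ = M * B := by
    rw [hMB, fromBlocks_transpose, hpinv.symm_left]
    simp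
  have hBM : B * M = M * B := by
    have hMT : Mᵀ = M := by simp [hM, fromBlocks_transpose, hD.eq, hc.eq]
    have hBT : Bᵀ = B := by
      simp [hB, fromBlocks_transpose, hE.eq, hS_inv_symm, Matrix.transpose_mul, Matrix.mul_assoc]
    rw [← hBT, ← hMT, ← Matrix.transpose_mul, hMT, hBT, hMBT]
  refine ⟨?_, ?_, hMBT, by rw [hBM, hMBT]⟩
  · rw [hMB, hM, fromBlocks_multiply]
    simp [hpinv.mul_mul_self, Matrix.mul_assoc, hy, hV]
  · rw [hBM, hMB, hB, fromBlocks_multiply]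
    have hyproj : D * pinv D * y = y := by rw [mul_pinv_comm hD, Matrix.mul_assoc, hV, hy]
    have hproj : D * pinv D * pinv D = pinv D := by rw [mul_pinv_comm hD, hpinv.self_mul_mul]
    simp [Matrix.mul_add, ← Matrix.mul_assoc, hyproj, hproj]

section Bordered

variable {ι : Type*} [Fintype ι]

theorem pinv_fromBlocks_sub_fromBlocks {D : Matrix ι ι ℝ} {v y : ι → ℝ} {c : ℝ} (hD : D.IsSymm)
    (hy : pinv D *ᵥ v = y) (hv : D *ᵥ y = v) (hc : c ≠ 0) (hs : c - v ⬝ᵥ y ≠ 0) :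
    pinv (fromBlocks D (replicateCol Unit v) (replicateRow Unit v) (of fun _ _ => c)) -
        fromBlocks 0 0 0 (of fun _ _ => 1 / c) =
      fromBlocks (pinv D + (c - v ⬝ᵥ y)⁻¹ • vecMulVec y y)
        (-((c - v ⬝ᵥ y)⁻¹ • replicateCol Unit y)) (-((c - v ⬝ᵥ y)⁻¹ • replicateRow Unit y))
        (of fun _ _ => v ⬝ᵥ y * (c - v ⬝ᵥ y)⁻¹ * c⁻¹) := by
  set s := c - v ⬝ᵥ y with hs_def
  have hinv : (of fun _ _ => s : Matrix Unit Unit ℝ)⁻¹ = of fun _ _ => s⁻¹ :=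
    Matrix.inv_eq_right_inv (by ext; simp [Matrix.mul_apply, hs])
  have hpinv := (isMoorePenrose_fromBlocks (V := replicateCol Unit v)
    (y := replicateCol Unit y) (c := of fun _ _ => c) (S := of fun _ _ => s) hD (by ext; rfl)
    (by rw [← Matrix.replicateCol_mulVec, hy]) (by rw [← Matrix.replicateCol_mulVec, hv])
    (by ext; simp [Matrix.mul_apply, hs_def, dotProduct])
    (by simpa using hs)).pinv_eq
  rw [Matrix.transpose_replicateCol] at hpinv
  rw [hpinv, hinv]
  ext (j | j) (k | k)
  · simp [Matrix.mul_apply, vecMulVec_apply, mul_comm, mul_left_comm, mul_assoc]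
  · simp [Matrix.mul_apply, mul_comm]
  · simp [Matrix.mul_apply]
  · simp only [Matrix.sub_apply, fromBlocks_apply₂₂, Matrix.of_apply]
    field_simp
    rw [hs_def]
    ring

variable {α : Type*} {l : Filter α}

theorem isBigO_inv_of_le_abs {c : α → ℝ} {ε : ℝ} (hε : 0 < ε) (hc : ∀ᶠ m in l, ε ≤ |c m|) :
    (fun m => (c m)⁻¹) =O[l] fun _ => (1 : ℝ) := by
  refine IsBigO.of_bound ε⁻¹ ?_
  filter_upwards [hc] with m hm
  rw [norm_inv, Real.norm_eq_abs, norm_one, mul_one]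
  exact inv_anti₀ hε hm

theorem isLittleO_dotProduct {u v : α → ι → ℝ} (hu : ∀ j, (u · j) =o[l] fun _ => (1 : ℝ))
    (hv : ∀ j, (v · j) =O[l] fun _ => (1 : ℝ)) :
    (fun m => u m ⬝ᵥ v m) =o[l] fun _ => (1 : ℝ) :=
  IsLittleO.fun_sum fun j _ => by simpa using (hu j).mul_isBigO (hv j)

theorem tendsto_pinv_fromBlocks {D : α → Matrix ι ι ℝ} {v : α → ι → ℝ} {c : α → ℝ}
    (hD : ∀ m, (D m).IsSymm) (hv : ∀ m, ∃ u, D m *ᵥ u = v m)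
    (hlim : Tendsto (fun m => pinv (D m)) l (𝓝 0)) (hbd : ∃ B, ∀ m j, |v m j| ≤ B)
    (hc : ∃ ε > 0, ∀ m, ε ≤ |c m|) :
    Tendsto (fun m =>
        pinv (fromBlocks (D m) (replicateCol Unit (v m)) (replicateRow Unit (v m))
          (of fun _ _ => c m)) - fromBlocks 0 0 0 (of fun _ _ => 1 / c m)) l (𝓝 0) := by
  obtain ⟨B, hB⟩ := hbd
  obtain ⟨ε, hε, hcε⟩ := hc
  set y : α → ι → ℝ := fun m => pinv (D m) *ᵥ v m
  have hv_bdd : ∀ j, (fun m => v m j) =O[l] fun _ => (1 : ℝ) := fun j =>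
    isBigO_of_le' (c := B) _ fun m => by simpa using hB m j
  have hpinv : ∀ j k, (fun m => pinv (D m) j k) =o[l] fun _ => (1 : ℝ) := fun j k =>
    (isLittleO_one_iff ℝ).2 (tendsto_pi_nhds.1 (tendsto_pi_nhds.1 hlim j) k)
  have hy_small : ∀ j, (fun m => y m j) =o[l] fun _ => (1 : ℝ) := fun j =>
    isLittleO_dotProduct (hpinv j) hv_bdd
  have hvy_small : (fun m => v m ⬝ᵥ y m) =o[l] fun _ => (1 : ℝ) := by
    simpa only [dotProduct_comm] using isLittleO_dotProduct hy_small hv_bdd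
  have hschur : ∀ᶠ m in l, ε / 2 ≤ |c m - v m ⬝ᵥ y m| := by
    filter_upwards [((isLittleO_one_iff ℝ).1 hvy_small).abs.eventually_lt_const
      (u := ε / 2) (by rw [abs_zero]; positivity)] with m hm
    linarith [hcε m, abs_sub_abs_le_abs_sub (c m) (v m ⬝ᵥ y m)]
  have hschur_inv := isBigO_inv_of_le_abs (half_pos hε) hschur
  have hc_inv := isBigO_inv_of_le_abs hε (Eventually.of_forall hcε : ∀ᶠ m in l, ε ≤ |c m|)
  refine Tendsto.congr' (EventuallyEq.symm (hschur.mono fun m hm =>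
    pinv_fromBlocks_sub_fromBlocks (hD m) rfl
      (by obtain ⟨u, hu⟩ := hv m; rw [← hu, mulVec_pinv_mulVec_mulVec])
      (abs_pos.1 (hε.trans_le (hcε m))) (abs_pos.1 ((half_pos hε).trans_le hm)))) ?_
  refine tendsto_pi_nhds.2 fun j => tendsto_pi_nhds.2 fun k => (isLittleO_one_iff ℝ).1 ?_
  rcases j with j | j <;> rcases k with k | k <;>
    simp only [fromBlocks_apply₁₁, fromBlocks_apply₁₂, fromBlocks_apply₂₁, fromBlocks_apply₂₂,
      Matrix.of_apply, Matrix.add_apply, Matrix.neg_apply, Matrix.smul_apply, smul_eq_mul,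
      vecMulVec_apply, replicateCol_apply, replicateRow_apply]
  · exact (hpinv j k).add
      (by simpa using hschur_inv.mul_isLittleO ((hy_small j).mul (hy_small k)))
  · exact IsLittleO.neg_left (by simpa using hschur_inv.mul_isLittleO (hy_small j))
  · exact IsLittleO.neg_left (by simpa using hschur_inv.mul_isLittleO (hy_small k))
  · simpa using (hvy_small.mul_isBigO hschur_inv).mul_isBigO hc_inv

end Bordered

/-! ### Moments of sums over product weights -/

theorem sum_comp_cons {X : Type*} {m : ℕ} (f : X → ℝ) (a : X) (x : Fin m → X) :
    ∑ r, f ((Fin.cons a x : Fin (m + 1) → X) r) = f a + ∑ r, f (x r) := by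
  simp only [Fin.sum_univ_succ, Fin.cons_zero, Fin.cons_succ]

section Moments

variable {X : Type*} [Fintype X]

/-- The sum of `F` over `X ^ m` against the product weight `∏ r, A (x r)`; it is the expectation of
`F` under `m` independent repetitions when `A` is a probability vector. -/
def iidSum (A : X → ℝ) (m : ℕ) (F : (Fin m → X) → ℝ) : ℝ :=
  ∑ x : Fin m → X, (∏ r, A (x r)) * F x

variable (A : X → ℝ)

theorem iidSum_zero (F : (Fin 0 → X) → ℝ) : iidSum A 0 F = F Fin.elim0 := by
  simp only [iidSum, Finset.univ_unique, Finset.univ_eq_empty, Finset.prod_empty, one_mul,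
    Finset.sum_singleton]
  exact congrArg F (Subsingleton.elim _ _)

theorem iidSum_succ (m : ℕ) (F : (Fin (m + 1) → X) → ℝ) :
    iidSum A (m + 1) F = ∑ a, A a * iidSum A m fun x => F (Fin.cons a x) := by
  unfold iidSum
  rw [← (Fin.consEquiv fun _ : Fin (m + 1) => X).sum_comp, Fintype.sum_prod_type]
  refine Finset.sum_congr rfl fun a _ => ?_
  rw [Finset.mul_sum]
  refine Finset.sum_congr rfl fun x _ => ?_
  simp only [Fin.consEquiv, Equiv.coe_fn_mk, Fin.prod_univ_succ, Fin.cons_zero, Fin.cons_succ]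
  ring

theorem iidSum_add (m : ℕ) (F G : (Fin m → X) → ℝ) :
    iidSum A m (fun x => F x + G x) = iidSum A m F + iidSum A m G := by
  simp only [iidSum, mul_add, Finset.sum_add_distrib]

theorem iidSum_const_mul (m : ℕ) (c : ℝ) (F : (Fin m → X) → ℝ) :
    iidSum A m (fun x => c * F x) = c * iidSum A m F := by
  simp only [iidSum, Finset.mul_sum, mul_left_comm]

theorem iidSum_finsetSum {ι : Type*} (s : Finset ι) (m : ℕ) (F : ι → (Fin m → X) → ℝ) :
    iidSum A m (fun x => ∑ z ∈ s, F z x) = ∑ z ∈ s, iidSum A m (F z) := by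
  simp only [iidSum, Finset.mul_sum]
  exact Finset.sum_comm

theorem iidSum_const (m : ℕ) (c : ℝ) : iidSum A m (fun _ => c) = c * (∑ a, A a) ^ m := by
  rw [iidSum, ← Finset.sum_mul, ← Fintype.sum_pow, mul_comm]

theorem iidSum_mono {A : X → ℝ} (hA : ∀ a, 0 ≤ A a) {m : ℕ} {F G : (Fin m → X) → ℝ}
    (h : ∀ x, F x ≤ G x) : iidSum A m F ≤ iidSum A m G :=
  Finset.sum_le_sum fun x _ =>
    mul_le_mul_of_nonneg_left (h x) (Finset.prod_nonneg fun r _ => hA (x r))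

theorem iidSum_sum (m : ℕ) (f : X → ℝ) :
    iidSum A m (fun x => ∑ r, f (x r)) = m * (∑ a, A a) ^ (m - 1) * ∑ a, A a * f a := by
  induction m with
  | zero => simp [iidSum_zero]
  | succ m ih =>
    simp only [iidSum_succ, sum_comp_cons, iidSum_add, iidSum_const, ih, mul_add,
      Finset.sum_add_distrib, ← mul_assoc, ← Finset.sum_mul]
    rcases m with _ | m
    · simp
    · push_cast
      simp only [pow_succ]
      ring

theorem iidSum_succ_sum_mul_sum (m : ℕ) (f g : X → ℝ) :
    iidSum A (m + 1) (fun x => (∑ r, f (x r)) * ∑ r, g (x r)) =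
      (∑ a, A a) ^ m * ∑ a, A a * (f a * g a) +
        2 * (m * (∑ a, A a) ^ (m - 1)) * ((∑ a, A a * f a) * ∑ a, A a * g a) +
        (∑ a, A a) * iidSum A m (fun x => (∑ r, f (x r)) * ∑ r, g (x r)) := by
  have hexpand : ∀ (a : X) (x : Fin m → X),
      (f a + ∑ r, f (x r)) * (g a + ∑ r, g (x r)) =
        f a * g a + f a * (∑ r, g (x r)) + g a * (∑ r, f (x r)) +
          (∑ r, f (x r)) * ∑ r, g (x r) := fun a x => by ring
  simp only [iidSum_succ, sum_comp_cons, hexpand, iidSum_add, iidSum_const_mul, iidSum_const,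
    iidSum_sum, mul_add, Finset.sum_add_distrib, ← mul_assoc, ← Finset.sum_mul]
  ring

theorem iidSum_sum_mul_sum (m : ℕ) (f g : X → ℝ) :
    iidSum A m (fun x => (∑ r, f (x r)) * ∑ r, g (x r)) =
      (m : ℝ) * ((m : ℝ) - 1) * (∑ a, A a) ^ (m - 2) * ((∑ a, A a * f a) * ∑ a, A a * g a) +
        (m : ℝ) * (∑ a, A a) ^ (m - 1) * ∑ a, A a * (f a * g a) := by
  induction m with
  | zero => simp [iidSum_zero]
  | succ m ih =>
    rw [iidSum_succ_sum_mul_sum, ih]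
    rcases m with _ | _ | m
    · simp
    · simp
      ring
    · push_cast
      simp only [Nat.add_assoc, Nat.reduceAdd, pow_succ]
      ring

variable {A}

theorem iidSum_sq_of_centered (hA : ∑ a, A a = 1) {f : X → ℝ} (hf : ∑ a, A a * f a = 0) (m : ℕ) :
    iidSum A m (fun x => (∑ r, f (x r)) ^ 2) = m * ∑ a, A a * f a ^ 2 := by
  simp only [sq, iidSum_sum_mul_sum, hA, hf, one_pow]
  ring

theorem iidSum_succ_pow_four_of_centered (hA : ∑ a, A a = 1) {f : X → ℝ}
    (hf : ∑ a, A a * f a = 0) (m : ℕ) :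
    iidSum A (m + 1) (fun x => (∑ r, f (x r)) ^ 4) =
      ∑ a, A a * f a ^ 4 + 6 * m * (∑ a, A a * f a ^ 2) ^ 2 +
        iidSum A m (fun x => (∑ r, f (x r)) ^ 4) := by
  have hexpand : ∀ (a : X) (x : Fin m → X), (f a + ∑ r, f (x r)) ^ 4 =
      f a ^ 4 + 4 * f a ^ 3 * (∑ r, f (x r)) + 6 * f a ^ 2 * (∑ r, f (x r)) ^ 2 +
        f a * (4 * (∑ r, f (x r)) ^ 3) + (∑ r, f (x r)) ^ 4 := fun a x => by ring
  simp only [iidSum_succ, sum_comp_cons, hexpand, iidSum_add, iidSum_const_mul, iidSum_const,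
    iidSum_sum, iidSum_sq_of_centered hA hf, hf, mul_add, Finset.sum_add_distrib, ← mul_assoc,
    ← Finset.sum_mul, hA, mul_right_comm _ (6 : ℝ), one_pow]
  ring

theorem iidSum_pow_four_le (hA0 : ∀ a, 0 ≤ A a) (hA : ∑ a, A a = 1) {f : X → ℝ}
    (hf : ∑ a, A a * f a = 0) (hf1 : ∀ a, |f a| ≤ 1) (m : ℕ) :
    iidSum A m (fun x => (∑ r, f (x r)) ^ 4) ≤ 3 * (m : ℝ) ^ 2 := by
  have hle : ∀ k, Even k → ∑ a, A a * f a ^ k ≤ 1 := fun k hk => by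
    rw [← hA]
    refine Finset.sum_le_sum fun a _ => mul_le_of_le_one_right (hA0 a) ?_
    rw [← hk.pow_abs]
    exact pow_le_one₀ (abs_nonneg _) (hf1 a)
  induction m with
  | zero => simp [iidSum_zero]
  | succ m ih =>
    have hvar : (∑ a, A a * f a ^ 2) ^ 2 ≤ 1 :=
      pow_le_one₀ (Finset.sum_nonneg fun a _ => mul_nonneg (hA0 a) (sq_nonneg _))
        (hle 2 even_two)
    have hcross : (6 * m : ℝ) * (∑ a, A a * f a ^ 2) ^ 2 ≤ 6 * m :=
      mul_le_of_le_one_right (by positivity) hvar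
    rw [iidSum_succ_pow_four_of_centered hA hf]
    push_cast
    linarith [hle 4 (by decide)]

end Moments

/-! ### Scores of independent repetitions -/

/-- The chi-square pairing `∑ x, f x * g x / P x`, the inner product of `f / P` and `g / P` in
`L²(P)`. -/
noncomputable def overlap {X : Type*} [Fintype X] (P f g : X → ℝ) : ℝ :=
  ∑ x, f x * g x / P x

/-- The derivative of the product weight `∏ r, q (x r)` in the direction `u`. -/
noncomputable def tensorScore {X : Type*} (q u : X → ℝ) (m : ℕ) (x : Fin m → X) : ℝ :=
  (∏ r, q (x r)) * ∑ r, u (x r) / q (x r)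

theorem tensorScore_sum_mul {X ι : Type*} (q : X → ℝ) (s : Finset ι) (a : ι → ℝ)
    (u : ι → X → ℝ) (m : ℕ) (x : Fin m → X) :
    tensorScore q (fun z => ∑ j ∈ s, a j * u j z) m x =
      ∑ j ∈ s, a j * tensorScore q (u j) m x := by
  simp only [tensorScore, Finset.sum_div, Finset.mul_sum]
  rw [Finset.sum_comm]
  exact Finset.sum_congr rfl fun j _ => Finset.sum_congr rfl fun r _ => by ring

section TensorScore

variable {X : Type*} [Fintype X]

theorem overlap_self_left {P : X → ℝ} (hP : ∀ x, P x ≠ 0) (f : X → ℝ) :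
    overlap P P f = ∑ x, f x :=
  Finset.sum_congr rfl fun x _ => mul_div_cancel_left₀ _ (hP x)

theorem sum_tensorScore {q : X → ℝ} (hq : ∀ x, q x ≠ 0) (u : X → ℝ) (m : ℕ) :
    ∑ x, tensorScore q u m x = m * (∑ x, q x) ^ (m - 1) * ∑ x, u x := by
  have hmoment := iidSum_sum q m fun x => u x / q x
  simp only [mul_div_cancel₀ _ (hq _)] at hmoment
  exact hmoment

theorem sum_tensorScore_mul_tensorScore (P : X → ℝ) {q q' : X → ℝ} (hq : ∀ x, q x ≠ 0)
    (hq' : ∀ x, q' x ≠ 0) (u u' : X → ℝ) (m : ℕ) :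
    ∑ x, tensorScore q u m x * tensorScore q' u' m x / ∏ r, P (x r) =
      (m : ℝ) * ((m : ℝ) - 1) * overlap P q q' ^ (m - 2) * (overlap P q' u * overlap P q u') +
        (m : ℝ) * overlap P q q' ^ (m - 1) * overlap P u u' := by
  have hmoments := iidSum_sum_mul_sum (fun x => q x * q' x / P x) m (fun x => u x / q x)
    (fun x => u' x / q' x)
  have hcancel : ∀ x, q x * q' x / P x * (u x / q x) = q' x * u x / P x := fun x => by
    have := hq x
    field_simp
  have hcancel' : ∀ x, q x * q' x / P x * (u' x / q' x) = q x * u' x / P x := fun x => by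
    have := hq' x
    field_simp
  have hcancel₂ : ∀ x, q x * q' x / P x * (u x / q x * (u' x / q' x)) = u x * u' x / P x :=
    fun x => by
      have := hq x
      have := hq' x
      field_simp
  simp only [hcancel, hcancel', hcancel₂] at hmoments
  refine Eq.trans (Finset.sum_congr rfl fun x _ => ?_) hmoments
  rw [Finset.prod_div_distrib, Finset.prod_mul_distrib, tensorScore, tensorScore]
  ring

end TensorScore

section Scores

variable {X : Type*} {n : ℕ} {p : X → ℝ → ℝ} {θ : Fin n → ℝ}

theorem hasDerivAt_jointProb {t : ℝ} (hp : ∀ x, p x t ≠ 0)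
    (hdiff : ∀ x, DifferentiableAt ℝ (p x) t) (m : ℕ) (x : Fin m → X) :
    HasDerivAt (jointProb p m x)
      (tensorScore (fun x => p x t) (fun x => deriv (p x) t) m x) t := by
  have hprod := HasDerivAt.fun_finsetProd (u := Finset.univ) (f := fun r => p (x r))
    (f' := fun r => deriv (p (x r)) t) (x := t) fun r _ => (hdiff (x r)).hasDerivAt
  refine HasDerivAt.congr_deriv (f := jointProb p m x) hprod ?_
  rw [tensorScore, Finset.mul_sum]
  refine Finset.sum_congr rfl fun r _ => ?_
  rw [smul_eq_mul, ← Finset.mul_prod_erase _ _ (Finset.mem_univ r)]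
  have := hp (x r)
  field_simp

theorem dist_m_pos (hpos : ∀ i x, 0 < p x (θ i)) (m : ℕ) (i : Fin n) (x : Fin m → X) :
    0 < dist_m p θ m i x := by
  unfold dist_m jointProb
  exact Finset.prod_pos fun r _ => hpos i (x r)

theorem score_m_eq_tensorScore (hpos : ∀ i x, 0 < p x (θ i))
    (hdiff : ∀ i x, DifferentiableAt ℝ (p x) (θ i)) (m : ℕ) :
    score_m p θ m = fun j => tensorScore (fun x => p x (θ j)) (fun x => deriv (p x) (θ j)) m := by
  funext j x
  exact (hasDerivAt_jointProb (fun x => (hpos j x).ne') (hdiff j) m x).deriv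

variable [Fintype X]

theorem infoRep_eq_overlap (hpos : ∀ i x, 0 < p x (θ i))
    (hdiff : ∀ i x, DifferentiableAt ℝ (p x) (θ i)) (m : ℕ) (i j k : Fin n) :
    infoRep p θ i m j k =
      (m : ℝ) * ((m : ℝ) - 1) * lam p θ i j k ^ (m - 2) * (rCoef p θ i j k * rCoef p θ i k j) +
        (m : ℝ) * lam p θ i j k ^ (m - 1) * overlap (fun x => p x (θ i))
          (fun x => deriv (p x) (θ j)) fun x => deriv (p x) (θ k) := by
  rw [infoRep, score_m_eq_tensorScore hpos hdiff]
  exact sum_tensorScore_mul_tensorScore (fun x => p x (θ i)) (q := fun x => p x (θ j))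
    (q' := fun x => p x (θ k)) (fun x => (hpos j x).ne') (fun x => (hpos k x).ne')
    (fun x => deriv (p x) (θ j)) (fun x => deriv (p x) (θ k)) m

theorem infoRep_one (hpos : ∀ i x, 0 < p x (θ i))
    (hdiff : ∀ i x, DifferentiableAt ℝ (p x) (θ i)) (i j k : Fin n) :
    infoRep p θ i 1 j k = ∑ x, deriv (p x) (θ j) * deriv (p x) (θ k) / p x (θ i) := by
  simp [infoRep_eq_overlap hpos hdiff, overlap]

theorem infoRep_one_self (hpos : ∀ i x, 0 < p x (θ i))
    (hdiff : ∀ i x, DifferentiableAt ℝ (p x) (θ i)) (i : Fin n) :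
    infoRep p θ i 1 i i = fisherInfo p (θ i) := by
  simp only [infoRep_one hpos hdiff, fisherInfo, sq]

theorem infoRep_eq (hpos : ∀ i x, 0 < p x (θ i))
    (hdiff : ∀ i x, DifferentiableAt ℝ (p x) (θ i)) (m : ℕ) (i j k : Fin n) :
    infoRep p θ i m j k =
      (m : ℝ) * ((m : ℝ) - 1) * lam p θ i j k ^ (m - 2) * (rCoef p θ i j k * rCoef p θ i k j) +
        (m : ℝ) * lam p θ i j k ^ (m - 1) * infoRep p θ i 1 j k := by
  rw [infoRep_one hpos hdiff]
  exact infoRep_eq_overlap hpos hdiff m i j k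

theorem infoRep_self (hpos : ∀ i x, 0 < p x (θ i))
    (hdiff : ∀ i x, DifferentiableAt ℝ (p x) (θ i)) {i : Fin n} (hsum : ∑ x, p x (θ i) = 1)
    (hderiv : ∑ x, deriv (p x) (θ i) = 0) (m : ℕ) :
    infoRep p θ i m i i = m * fisherInfo p (θ i) := by
  have hlam : lam p θ i i i = 1 := (overlap_self_left (fun x => (hpos i x).ne') _).trans hsum
  have hrCoef : rCoef p θ i i i = 0 :=
    (overlap_self_left (fun x => (hpos i x).ne') _).trans hderiv
  rw [infoRep_eq hpos hdiff, hlam, hrCoef, infoRep_one_self hpos hdiff]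
  simp

theorem sum_deriv_eq_zero {t c : ℝ} (hsum : ∀ᶠ s in 𝓝 t, ∑ x, p x s = c)
    (hdiff : ∀ x, DifferentiableAt ℝ (p x) t) : ∑ x, deriv (p x) t = 0 := by
  rw [← deriv_fun_sum fun x _ => hdiff x, EventuallyEq.deriv_eq hsum, deriv_const]

theorem sum_score_m (hpos : ∀ i x, 0 < p x (θ i))
    (hdiff : ∀ i x, DifferentiableAt ℝ (p x) (θ i)) {j : Fin n}
    (hderiv : ∑ x, deriv (p x) (θ j) = 0) (m : ℕ) : ∑ x, score_m p θ m j x = 0 := by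
  rw [score_m_eq_tensorScore hpos hdiff, sum_tensorScore (fun x => (hpos j x).ne'), hderiv,
    mul_zero]

theorem biasRep_eq_sum_mul (hpos : ∀ i x, 0 < p x (θ i))
    (hdiff : ∀ i x, DifferentiableAt ℝ (p x) (θ i)) {j : Fin n}
    (hderiv : ∑ x, deriv (p x) (θ j) = 0) (est : EstimatorSeq X) (i : Fin n) (m : ℕ) :
    biasRep p θ est i j m = ∑ x, score_m p θ m j x * est m x := by
  simp only [biasRep, biasVec, mul_sub, Finset.sum_sub_distrib, ← Finset.sum_mul,
    sum_score_m hpos hdiff hderiv, zero_mul, sub_zero]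

end Scores

/-! ### Asymptotic orthogonality of scores -/

/-- The norm associated with `overlap P`. -/
noncomputable def overlapNorm {X : Type*} [Fintype X] (P f : X → ℝ) : ℝ :=
  √(overlap P f f)

/-- The cosine of the angle between `f` and `g` for the inner product `overlap P`. -/
noncomputable def overlapCos {X : Type*} [Fintype X] (P f g : X → ℝ) : ℝ :=
  overlap P f g / (overlapNorm P f * overlapNorm P g)

section Overlap

variable {X : Type*} [Fintype X] {P : X → ℝ}

theorem overlap_eq_inner (hP : ∀ x, 0 ≤ P x) (f g : X → ℝ) :
    overlap P f g = inner ℝ (WithLp.toLp 2 fun x => f x / √(P x) : EuclideanSpace ℝ X)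
      (WithLp.toLp 2 fun x => g x / √(P x)) := by
  simp only [overlap, PiLp.inner_apply, RCLike.inner_apply, conj_trivial]
  refine Finset.sum_congr rfl fun x _ => ?_
  rw [div_mul_div_comm, Real.mul_self_sqrt (hP x), mul_comm]

theorem overlapNorm_eq_norm (hP : ∀ x, 0 ≤ P x) (f : X → ℝ) :
    overlapNorm P f = ‖(WithLp.toLp 2 fun x => f x / √(P x) : EuclideanSpace ℝ X)‖ := by
  rw [overlapNorm, overlap_eq_inner hP, norm_eq_sqrt_real_inner]

theorem overlap_nonneg (hP : ∀ x, 0 ≤ P x) {f g : X → ℝ} (hf : ∀ x, 0 ≤ f x)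
    (hg : ∀ x, 0 ≤ g x) : 0 ≤ overlap P f g :=
  Finset.sum_nonneg fun x _ => div_nonneg (mul_nonneg (hf x) (hg x)) (hP x)

theorem overlapNorm_nonneg (P f : X → ℝ) : 0 ≤ overlapNorm P f :=
  Real.sqrt_nonneg _

theorem sq_overlapNorm (hP : ∀ x, 0 ≤ P x) (f : X → ℝ) :
    overlapNorm P f ^ 2 = overlap P f f :=
  Real.sq_sqrt (Finset.sum_nonneg fun x _ => div_nonneg (mul_self_nonneg _) (hP x))

theorem abs_overlap_le (hP : ∀ x, 0 ≤ P x) (f g : X → ℝ) :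
    |overlap P f g| ≤ overlapNorm P f * overlapNorm P g := by
  rw [overlap_eq_inner hP, overlapNorm_eq_norm hP, overlapNorm_eq_norm hP]
  exact abs_real_inner_le_norm _ _

theorem overlapNorm_pos (hP : ∀ x, 0 < P x) {q : X → ℝ} (hq : ∑ x, q x ≠ 0) :
    0 < overlapNorm P q := by
  obtain ⟨x, -, hx⟩ := Finset.exists_ne_zero_of_sum_ne_zero hq
  exact Real.sqrt_pos.2 <| Finset.sum_pos'
    (fun x _ => div_nonneg (mul_self_nonneg _) (hP x).le)
    ⟨x, Finset.mem_univ _, div_pos (mul_self_pos.2 hx) (hP x)⟩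

theorem overlap_lt_of_ne (hP : ∀ x, 0 < P x) {q q' : X → ℝ} (hq : ∑ x, q x = 1)
    (hq' : ∑ x, q' x = 1) (hne : q ≠ q') :
    overlap P q q' < overlapNorm P q * overlapNorm P q' := by
  rw [overlap_eq_inner fun x => (hP x).le, overlapNorm_eq_norm fun x => (hP x).le,
    overlapNorm_eq_norm fun x => (hP x).le, inner_lt_norm_mul_iff_real,
    ← overlapNorm_eq_norm fun x => (hP x).le, ← overlapNorm_eq_norm fun x => (hP x).le]
  intro hparallel
  have hpoint : ∀ x, overlapNorm P q' * q x = overlapNorm P q * q' x := fun x => by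
    have hx := congrArg (fun v : EuclideanSpace ℝ X => v x) hparallel
    simp only [PiLp.smul_apply, smul_eq_mul, ← mul_div_assoc] at hx
    exact (div_left_inj' (Real.sqrt_ne_zero'.2 (hP x))).1 hx
  have hnorm : overlapNorm P q' = overlapNorm P q := by
    simpa only [← Finset.mul_sum, hq, hq', mul_one] using
      Finset.sum_congr rfl fun x (_ : x ∈ Finset.univ) => hpoint x
  refine hne (funext fun x => ?_)
  have hx := hpoint x
  rw [hnorm] at hx
  exact mul_left_cancel₀ (overlapNorm_pos hP (hq.trans_ne one_ne_zero)).ne' hx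

theorem overlapCos_nonneg (hP : ∀ x, 0 ≤ P x) {q q' : X → ℝ} (hq : ∀ x, 0 ≤ q x)
    (hq' : ∀ x, 0 ≤ q' x) : 0 ≤ overlapCos P q q' :=
  div_nonneg (overlap_nonneg hP hq hq')
    (mul_nonneg (overlapNorm_nonneg P q) (overlapNorm_nonneg P q'))

theorem overlapCos_lt_one (hP : ∀ x, 0 < P x) {q q' : X → ℝ} (hq : ∑ x, q x = 1)
    (hq' : ∑ x, q' x = 1) (hne : q ≠ q') : overlapCos P q q' < 1 := by
  rw [overlapCos, div_lt_one (mul_pos (overlapNorm_pos hP (hq.trans_ne one_ne_zero))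
    (overlapNorm_pos hP (hq'.trans_ne one_ne_zero)))]
  exact overlap_lt_of_ne hP hq hq' hne

theorem overlapCos_mul (hP : ∀ x, 0 < P x) {q q' : X → ℝ} (hq : ∑ x, q x ≠ 0)
    (hq' : ∑ x, q' x ≠ 0) :
    overlapCos P q q' * (overlapNorm P q * overlapNorm P q') = overlap P q q' :=
  div_mul_cancel₀ _ (mul_pos (overlapNorm_pos hP hq) (overlapNorm_pos hP hq')).ne'

end Overlap

/-- A bound for the relative size of the overlap of two scores over `m` repetitions, when `ρ` is
the cosine of the angle between the two distributions. -/
noncomputable def crossCoef (ρ : ℝ) (m : ℕ) : ℝ :=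
  ((m : ℝ) - 1) * ρ ^ (m - 2) + ρ ^ (m - 1)

theorem crossCoef_add_two (ρ : ℝ) (m : ℕ) :
    crossCoef ρ (m + 2) = (m + 1) * ρ ^ m + ρ ^ (m + 1) := by
  simp only [crossCoef, Nat.add_sub_cancel, show m + 2 - 1 = m + 1 from rfl]
  push_cast
  ring

theorem crossCoef_nonneg {ρ : ℝ} (hρ : 0 ≤ ρ) {m : ℕ} (hm : 2 ≤ m) : 0 ≤ crossCoef ρ m := by
  obtain ⟨k, rfl⟩ := Nat.exists_eq_add_of_le' hm
  rw [crossCoef_add_two]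
  positivity

theorem tendsto_crossCoef {ρ : ℝ} (h0 : 0 ≤ ρ) (h1 : ρ < 1) :
    Tendsto (crossCoef ρ) atTop (𝓝 0) := by
  rw [← tendsto_add_atTop_iff_nat 2]
  have hpow := tendsto_pow_atTop_nhds_zero_of_lt_one h0 h1
  have hmul := tendsto_self_mul_const_pow_of_lt_one h0 h1
  have hsum := (hmul.add hpow).add (hpow.mul_const ρ)
  simp only [zero_mul, add_zero] at hsum
  refine hsum.congr fun m => ?_
  rw [crossCoef_add_two]
  ring

theorem le_sum_sum_of_offDiag_le {α : Type*} {S : Finset α} {I c : α → α → ℝ}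
    {y : α → ℝ} (hdiag : ∀ q ∈ S, y q ^ 2 ≤ I q q)
    (hc : ∀ q ∈ S, ∀ q' ∈ S, q ≠ q' → 0 ≤ c q q')
    (hoff : ∀ q ∈ S, ∀ q' ∈ S, q ≠ q' → |I q q'| ≤ c q q' * (y q * y q')) :
    (1 - ∑ z ∈ S.offDiag, c z.1 z.2) * ∑ q ∈ S, y q ^ 2 ≤ ∑ q ∈ S, ∑ q' ∈ S, I q q' := by
  classical
  have hcross : ∀ z ∈ S.offDiag, -(c z.1 z.2 * ∑ q ∈ S, y q ^ 2) ≤ I z.1 z.2 := fun z hz => by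
    obtain ⟨h₁, h₂, hne⟩ := Finset.mem_offDiag.1 hz
    have hpair : y z.1 ^ 2 + y z.2 ^ 2 ≤ ∑ q ∈ S, y q ^ 2 := by
      rw [← Finset.sum_pair (f := fun q => y q ^ 2) hne]
      exact Finset.sum_le_sum_of_subset_of_nonneg (by simp [Finset.insert_subset_iff, h₁, h₂])
        fun q _ _ => sq_nonneg _
    have hyoung : y z.1 * y z.2 ≤ ∑ q ∈ S, y q ^ 2 := by
      nlinarith [sq_nonneg (y z.1 - y z.2), sq_nonneg (y z.1), sq_nonneg (y z.2)]
    exact (neg_le_neg ((hoff _ h₁ _ h₂ hne).trans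
      (mul_le_mul_of_nonneg_left hyoung (hc _ h₁ _ h₂ hne)))).trans (neg_abs_le _)
  rw [← Finset.sum_product', ← Finset.diag_union_offDiag,
    Finset.sum_union (Finset.disjoint_diag_offDiag S), Finset.sum_diag, sub_mul, one_mul,
    sub_eq_add_neg, Finset.sum_mul, ← Finset.sum_neg_distrib]
  exact add_le_add (Finset.sum_le_sum hdiag) (Finset.sum_le_sum hcross)

section Gram

variable {X : Type*} [Fintype X] {P : X → ℝ}

theorem mul_overlap_le_sum_sq_tensorScore (hP : ∀ x, 0 ≤ P x) {q : X → ℝ} (hq : ∀ x, q x ≠ 0)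
    (u : X → ℝ) {m : ℕ} (hm : 1 ≤ m) :
    m * (overlapNorm P q ^ (m - 1) * overlapNorm P u) ^ 2 ≤
      ∑ x, tensorScore q u m x * tensorScore q u m x / ∏ r, P (x r) := by
  have hm' : (1 : ℝ) ≤ m := by exact_mod_cast hm
  rw [sum_tensorScore_mul_tensorScore P hq hq, mul_pow, ← pow_mul, mul_comm (m - 1), pow_mul,
    sq_overlapNorm hP, sq_overlapNorm hP, mul_assoc _ (_ ^ (m - 1))]
  exact le_add_of_nonneg_left (mul_nonneg (mul_nonneg (mul_nonneg (by linarith) (by linarith))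
    (pow_nonneg (sq_overlapNorm hP q ▸ sq_nonneg _) _)) (mul_self_nonneg _))

theorem abs_sum_tensorScore_mul_tensorScore_le (hP : ∀ x, 0 < P x) {q q' : X → ℝ}
    (hq : ∀ x, 0 < q x) (hq' : ∀ x, 0 < q' x) (hq1 : ∑ x, q x = 1) (hq1' : ∑ x, q' x = 1)
    (u u' : X → ℝ) {m : ℕ} (hm : 2 ≤ m) :
    |∑ x, tensorScore q u m x * tensorScore q' u' m x / ∏ r, P (x r)| ≤
      m * (crossCoef (overlapCos P q q') m *
        ((overlapNorm P q ^ (m - 1) * overlapNorm P u) *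
          (overlapNorm P q' ^ (m - 1) * overlapNorm P u'))) := by
  obtain ⟨k, rfl⟩ := Nat.exists_eq_add_of_le' hm
  have hP' := fun x => (hP x).le
  have hcos := overlapCos_nonneg hP' (fun x => (hq x).le) fun x => (hq' x).le
  have hmixed : |overlap P q' u * overlap P q u'| ≤
      (overlapNorm P q' * overlapNorm P u) * (overlapNorm P q * overlapNorm P u') := by
    rw [abs_mul]
    exact mul_le_mul (abs_overlap_le hP' q' u) (abs_overlap_le hP' q u') (abs_nonneg _)
      (mul_nonneg (overlapNorm_nonneg P q') (overlapNorm_nonneg P u))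
  have hdirect := abs_overlap_le hP' u u'
  rw [sum_tensorScore_mul_tensorScore P (fun x => (hq x).ne') fun x => (hq' x).ne',
    crossCoef_add_two, ← overlapCos_mul hP (hq1.trans_ne one_ne_zero) (hq1'.trans_ne one_ne_zero),
    Nat.add_sub_cancel, show k + 2 - 1 = k + 1 from rfl]
  have hnorm := overlapNorm_nonneg P q
  have hnorm' := overlapNorm_nonneg P q'
  generalize overlapCos P q q' = ρ at *
  generalize overlapNorm P q = l at *
  generalize overlapNorm P q' = l' at *
  calc _ ≤ ((k + 2 : ℕ) : ℝ) * (k + 1) * (ρ * (l * l')) ^ k *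
          ((l' * overlapNorm P u) * (l * overlapNorm P u')) +
        ((k + 2 : ℕ) : ℝ) * (ρ * (l * l')) ^ (k + 1) * (overlapNorm P u * overlapNorm P u') := by
        refine (abs_add_le _ _).trans (add_le_add ?_ ?_)
        · rw [abs_mul, show ((k + 2 : ℕ) : ℝ) - 1 = k + 1 by push_cast; ring,
            abs_of_nonneg (by positivity)]
          exact mul_le_mul_of_nonneg_left hmixed (by positivity)
        · rw [abs_mul, abs_of_nonneg (by positivity)]
          exact mul_le_mul_of_nonneg_left hdirect (by positivity)
    _ = _ := by ring

/-- The total relative size of the overlaps between the scores of distinct members of `S`. -/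
noncomputable def crossTotal (P : X → ℝ) (S : Finset (X → ℝ)) (m : ℕ) : ℝ :=
  ∑ z ∈ S.offDiag, crossCoef (overlapCos P z.1 z.2) m

theorem tendsto_crossTotal (hP : ∀ x, 0 < P x) {S : Finset (X → ℝ)}
    (hS : ∀ q ∈ S, ∀ x, 0 < q x) (hS1 : ∀ q ∈ S, ∑ x, q x = 1) :
    Tendsto (crossTotal P S) atTop (𝓝 0) := by
  unfold crossTotal
  rw [← Finset.sum_const_zero (s := S.offDiag)]
  refine tendsto_finsetSum _ fun z hz => ?_
  obtain ⟨h₁, h₂, hne⟩ := Finset.mem_offDiag.1 hz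
  exact tendsto_crossCoef (overlapCos_nonneg (fun x => (hP x).le) (fun x => (hS _ h₁ x).le)
    fun x => (hS _ h₂ x).le) (overlapCos_lt_one hP (hS1 _ h₁) (hS1 _ h₂) hne)

theorem le_sum_sq_sum_tensorScore (hP : ∀ x, 0 < P x) {S : Finset (X → ℝ)}
    (hS : ∀ q ∈ S, ∀ x, 0 < q x) (hS1 : ∀ q ∈ S, ∑ x, q x = 1) (u : (X → ℝ) → X → ℝ) {m : ℕ}
    (hm : 2 ≤ m) :
    m * ((1 - crossTotal P S m) *
        ∑ q ∈ S, overlap P q q ^ (m - 1) * overlap P (u q) (u q)) ≤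
      ∑ x : Fin m → X, (∑ q ∈ S, tensorScore q (u q) m x) ^ 2 / ∏ r, P (x r) := by
  have hP' := fun x => (hP x).le
  have hm0 : (0 : ℝ) < m := by positivity
  have hdominated := le_sum_sum_of_offDiag_le (S := S)
    (I := fun q q' => (∑ x, tensorScore q (u q) m x * tensorScore q' (u q') m x / ∏ r, P (x r)) / m)
    (y := fun q => overlapNorm P q ^ (m - 1) * overlapNorm P (u q))
    (c := fun q q' => crossCoef (overlapCos P q q') m)
    (fun q hq => by
      rw [le_div_iff₀' hm0]
      exact mul_overlap_le_sum_sq_tensorScore hP' (fun x => (hS q hq x).ne') (u q)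
        (one_le_two.trans hm))
    (fun q hq q' hq' _ => crossCoef_nonneg (overlapCos_nonneg hP' (fun x => (hS q hq x).le)
      fun x => (hS q' hq' x).le) hm)
    (fun q hq q' hq' _ => by
      rw [abs_div, abs_of_pos hm0, div_le_iff₀' hm0]
      exact abs_sum_tensorScore_mul_tensorScore_le hP (hS q hq) (hS q' hq') (hS1 q hq)
        (hS1 q' hq') (u q) (u q') hm)
  simp only [← Finset.sum_div] at hdominated
  rw [le_div_iff₀' hm0] at hdominated
  refine (Eq.le ?_).trans (hdominated.trans (Eq.le ?_))
  · simp only [crossTotal, mul_pow, ← pow_mul, mul_comm (m - 1) 2, pow_mul _ 2,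
      sq_overlapNorm hP']
  · simp only [Finset.sum_comm (s := S) (t := Finset.univ), sq, Finset.sum_mul_sum,
      Finset.sum_div]

end Gram

/-! ### The limit of the pseudoinverse -/

section GroupInfo

variable {X : Type*} [Fintype X] {n : ℕ}

/-- The information matrix at the index `i` of `m` repetitions, for product distributions `Q j`
with score directions `W j`. -/
noncomputable def tensorInfo (Q W : Fin n → X → ℝ) (i : Fin n) (m : ℕ) :
    Matrix (Fin n) (Fin n) ℝ :=
  infoMatrix (fun j (x : Fin m → X) => ∏ r, Q j (x r)) (fun j => tensorScore (Q j) (W j) m) i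

/-- The part of the combination `∑ j, a j * W j` carried by the indices with `Q j = q`. -/
noncomputable def groupScore (Q W : Fin n → X → ℝ) (a : Fin n → ℝ) (q : X → ℝ) (x : X) : ℝ :=
  ∑ j, a j * if Q j = q then W j x else 0

/-- The information matrix at the index `i` of a single repetition, with all rows and columns
outside of the group `{j | Q j = q}` replaced by zero. -/
noncomputable def groupInfo (Q W : Fin n → X → ℝ) (i : Fin n) (q : X → ℝ) :
    Matrix (Fin n) (Fin n) ℝ :=
  infoMatrix Q (fun j x => if Q j = q then W j x else 0) i

/-- A lower bound for `(m : ℝ)⁻¹ • tensorInfo Q W i m` in which distinct groups are orthogonal. -/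
noncomputable def decoupledInfo (Q W : Fin n → X → ℝ) (i : Fin n) (m : ℕ) :
    Matrix (Fin n) (Fin n) ℝ :=
  (1 - crossTotal (Q i) (Finset.univ.image Q) m) •
    ∑ q ∈ Finset.univ.image Q, overlap (Q i) q q ^ (m - 1) • groupInfo Q W i q

variable (W : Fin n → X → ℝ) {Q : Fin n → X → ℝ} (i : Fin n)

theorem quadForm_groupInfo (a : Fin n → ℝ) (q : X → ℝ) :
    a ⬝ᵥ (groupInfo Q W i q *ᵥ a) =
      overlap (Q i) (groupScore Q W a q) (groupScore Q W a q) := by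
  simp only [groupInfo, quadForm_infoMatrix, sq, overlap, groupScore]

theorem groupInfo_isSymm (q : X → ℝ) : (groupInfo Q W i q).IsSymm :=
  infoMatrix_isSymm _ Q i

theorem groupInfo_mul_groupInfo {q q' : X → ℝ} (hne : q' ≠ q) :
    groupInfo Q W i q * groupInfo Q W i q' = 0 := by
  ext j k
  rw [Matrix.mul_apply]
  refine Finset.sum_eq_zero fun l _ => ?_
  rcases ne_or_eq (Q l) q with hl | rfl
  · simp [groupInfo, infoMatrix, hl]
  · simp [groupInfo, infoMatrix, hne.symm]

theorem sum_tensorScore_groupScore (a : Fin n → ℝ) (m : ℕ) (x : Fin m → X) :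
    ∑ q ∈ Finset.univ.image Q, tensorScore q (groupScore Q W a q) m x =
      ∑ j, a j * tensorScore (Q j) (W j) m x := by
  have hgroup : ∀ q j, tensorScore q (fun z => if Q j = q then W j z else 0) m x =
      if Q j = q then tensorScore (Q j) (W j) m x else 0 := fun q j => by
    split_ifs with h
    · rw [h]
    · simp [tensorScore]
  have hexpand : ∀ q, tensorScore q (groupScore Q W a q) m x =
      ∑ j, a j * if Q j = q then tensorScore (Q j) (W j) m x else 0 := fun q => by
    simp only [← hgroup]
    exact tensorScore_sum_mul q Finset.univ a _ m x
  simp only [hexpand]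
  rw [Finset.sum_comm]
  simp

theorem quadForm_tensorInfo (a : Fin n → ℝ) (m : ℕ) :
    a ⬝ᵥ (tensorInfo Q W i m *ᵥ a) =
      ∑ x : Fin m → X, (∑ q ∈ Finset.univ.image Q, tensorScore q (groupScore Q W a q) m x) ^ 2 /
        ∏ r, Q i (x r) := by
  simp only [tensorInfo, quadForm_infoMatrix, sum_tensorScore_groupScore]

theorem quadForm_decoupledInfo (a : Fin n → ℝ) (m : ℕ) :
    a ⬝ᵥ (decoupledInfo Q W i m *ᵥ a) =
      (1 - crossTotal (Q i) (Finset.univ.image Q) m) * ∑ q ∈ Finset.univ.image Q,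
        overlap (Q i) q q ^ (m - 1) *
          overlap (Q i) (groupScore Q W a q) (groupScore Q W a q) := by
  simp only [decoupledInfo, Matrix.smul_mulVec, Matrix.sum_mulVec, dotProduct_smul,
    dotProduct_sum, quadForm_groupInfo, smul_eq_mul]

theorem pinv_decoupledInfo (m : ℕ) :
    pinv (decoupledInfo Q W i m) =
      (1 - crossTotal (Q i) (Finset.univ.image Q) m)⁻¹ •
        ∑ q ∈ Finset.univ.image Q, (overlap (Q i) q q ^ (m - 1))⁻¹ • pinv (groupInfo Q W i q) := by
  rw [decoupledInfo, pinv_smul, pinv_sum_of_mul_eq_zero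
    (fun q _ => (groupInfo_isSymm W i q).smul _) fun q _ q' _ hne => by
      rw [Matrix.smul_mul, Matrix.mul_smul, groupInfo_mul_groupInfo W i hne, smul_zero, smul_zero]]
  simp only [pinv_smul]

variable (hQ : ∀ j x, 0 < Q j x)
include hQ

theorem tensorInfo_posSemidef (m : ℕ) : (tensorInfo Q W i m).PosSemidef :=
  infoMatrix_posSemidef _ fun _ => Finset.prod_pos fun _ _ => hQ i _

theorem groupInfo_posSemidef (q : X → ℝ) : (groupInfo Q W i q).PosSemidef :=
  infoMatrix_posSemidef _ (hQ i)

theorem groupInfo_mulVec_eq_zero_iff {a : Fin n → ℝ} {q : X → ℝ} :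
    groupInfo Q W i q *ᵥ a = 0 ↔ groupScore Q W a q = 0 :=
  (infoMatrix_mulVec_eq_zero_iff _ (hQ i)).trans funext_iff.symm

theorem decoupledInfo_posSemidef {m : ℕ}
    (hcross : crossTotal (Q i) (Finset.univ.image Q) m ≤ 1) :
    (decoupledInfo Q W i m).PosSemidef :=
  (Matrix.posSemidef_sum _ fun q _ => (groupInfo_posSemidef W i hQ q).smul (pow_nonneg
    (sq_overlapNorm (fun x => (hQ i x).le) q ▸ sq_nonneg _) _)).smul (sub_nonneg.2 hcross)

theorem groupScore_eq_zero_of_decoupledInfo {m : ℕ}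
    (hcross : crossTotal (Q i) (Finset.univ.image Q) m < 1) (hQ1 : ∀ j, ∑ x, Q j x = 1)
    {a : Fin n → ℝ} (ha : a ⬝ᵥ (decoupledInfo Q W i m *ᵥ a) ≤ 0) {q : X → ℝ}
    (hq : q ∈ Finset.univ.image Q) : groupScore Q W a q = 0 := by
  have hoverlap : ∀ q' ∈ Finset.univ.image Q, 0 < overlap (Q i) q' q' ^ (m - 1) := by
    simp only [Finset.mem_image, Finset.mem_univ, true_and, forall_exists_index,
      forall_apply_eq_imp_iff]
    intro j
    rw [← sq_overlapNorm fun x => (hQ i x).le]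
    exact pow_pos (pow_pos (overlapNorm_pos (hQ i) ((hQ1 j).trans_ne one_ne_zero)) 2) _
  have hgroup : ∀ q', 0 ≤ overlap (Q i) (groupScore Q W a q') (groupScore Q W a q') := fun q' =>
    sq_overlapNorm (fun x => (hQ i x).le) _ ▸ sq_nonneg _
  rw [quadForm_decoupledInfo] at ha
  have hterm := (Finset.sum_eq_zero_iff_of_nonneg fun q' hq' =>
    mul_nonneg (hoverlap q' hq').le (hgroup q')).1
      (le_antisymm (nonpos_of_mul_nonpos_right ha (sub_pos.2 hcross))
        (Finset.sum_nonneg fun q' hq' => mul_nonneg (hoverlap q' hq').le (hgroup q'))) q hq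
  rw [← groupInfo_mulVec_eq_zero_iff W i hQ,
    ← (groupInfo_posSemidef W i hQ q).dotProduct_mulVec_zero_iff, star_trivial,
    quadForm_groupInfo]
  exact (mul_eq_zero.1 hterm).resolve_left (hoverlap q hq).ne'

variable (hQ1 : ∀ j, ∑ x, Q j x = 1)
include hQ1

theorem tendsto_crossTotal_image :
    Tendsto (crossTotal (Q i) (Finset.univ.image Q)) atTop (𝓝 0) :=
  tendsto_crossTotal (hQ i) (by simpa using hQ) (by simpa using hQ1)

theorem quadForm_decoupledInfo_le {m : ℕ} (hm : 2 ≤ m) (a : Fin n → ℝ) :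
    a ⬝ᵥ (decoupledInfo Q W i m *ᵥ a) ≤ a ⬝ᵥ (((m : ℝ)⁻¹ • tensorInfo Q W i m) *ᵥ a) := by
  rw [Matrix.smul_mulVec, dotProduct_smul, smul_eq_mul, quadForm_decoupledInfo,
    quadForm_tensorInfo, le_inv_mul_iff₀ (by positivity)]
  exact le_sum_sq_sum_tensorScore (hQ i) (by simpa using hQ) (by simpa using hQ1) _ hm

theorem tensorInfo_mulVec_eq_zero_of_decoupledInfo {m : ℕ}
    (hcross : crossTotal (Q i) (Finset.univ.image Q) m < 1) {a : Fin n → ℝ}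
    (ha : decoupledInfo Q W i m *ᵥ a = 0) : tensorInfo Q W i m *ᵥ a = 0 := by
  rw [← (tensorInfo_posSemidef W i hQ m).dotProduct_mulVec_zero_iff, star_trivial,
    quadForm_tensorInfo]
  refine Finset.sum_eq_zero fun x _ => ?_
  rw [Finset.sum_eq_zero fun q hq => ?_, zero_pow two_ne_zero, zero_div]
  rw [groupScore_eq_zero_of_decoupledInfo W i hQ hcross hQ1 (by rw [ha, dotProduct_zero]) hq]
  simp [tensorScore]

theorem dotProduct_pinv_tensorInfo_le {m : ℕ} (hm : 2 ≤ m)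
    (hcross : crossTotal (Q i) (Finset.univ.image Q) m < 1) (x : Fin n → ℝ) :
    x ⬝ᵥ (pinv ((m : ℝ)⁻¹ • tensorInfo Q W i m) *ᵥ x) ≤
      x ⬝ᵥ (pinv (decoupledInfo Q W i m) *ᵥ x) := by
  refine dotProduct_pinv_le_dotProduct_pinv (decoupledInfo_posSemidef W i hQ hcross.le)
    ((tensorInfo_posSemidef W i hQ m).smul (by positivity)) (fun a ha => ?_)
    (quadForm_decoupledInfo_le W i hQ hQ1 hm _)
  rw [Matrix.smul_mulVec, tensorInfo_mulVec_eq_zero_of_decoupledInfo W i hQ hQ1 hcross ha,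
    smul_zero]

theorem one_lt_overlap_self {q : X → ℝ} (hq : ∑ x, q x = 1) (hne : q ≠ Q i) :
    1 < overlap (Q i) q q := by
  have hi : overlap (Q i) (Q i) (Q i) = 1 :=
    (overlap_self_left (fun x => (hQ i x).ne') _).trans (hQ1 i)
  have hlt := overlap_lt_of_ne (hQ i) (hQ1 i) hq hne.symm
  rw [overlap_self_left (fun x => (hQ i x).ne'), hq, overlapNorm, hi, Real.sqrt_one,
    one_mul] at hlt
  rw [← sq_overlapNorm (fun x => (hQ i x).le)]
  exact one_lt_pow₀ hlt two_ne_zero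

theorem tendsto_pinv_decoupledInfo :
    Tendsto (fun m => pinv (decoupledInfo Q W i m)) atTop (𝓝 (pinv (groupInfo Q W i (Q i)))) := by
  have hcross := ((tendsto_crossTotal_image i hQ hQ1).const_sub 1).inv₀ (by norm_num)
  have hgroup : ∀ q ∈ Finset.univ.image Q,
      Tendsto (fun m : ℕ => (overlap (Q i) q q ^ (m - 1))⁻¹ • pinv (groupInfo Q W i q)) atTop
        (𝓝 (if q = Q i then pinv (groupInfo Q W i (Q i)) else 0)) := fun q hq => by
    obtain ⟨j, -, rfl⟩ := Finset.mem_image.1 hq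
    split_ifs with h
    · simp [h, overlap_self_left (fun x => (hQ i x).ne'), hQ1]
    · rw [← zero_smul ℝ (pinv (groupInfo Q W i (Q j)))]
      exact (tendsto_inv_atTop_zero.comp ((tendsto_pow_atTop_atTop_of_one_lt
        (one_lt_overlap_self i hQ hQ1 (hQ1 j) h)).comp (tendsto_sub_atTop_nat 1))).smul_const _
  have hlim := hcross.smul (tendsto_finsetSum _ hgroup)
  simp only [pinv_decoupledInfo]
  simpa using hlim

variable {W} (hW : ∀ j, ∑ x, W j x = 0)

omit hQ hQ1 in
include hW in
theorem sum_groupScore (a : Fin n → ℝ) (q : X → ℝ) : ∑ x, groupScore Q W a q x = 0 := by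
  simp only [groupScore]
  rw [Finset.sum_comm]
  refine Finset.sum_eq_zero fun j _ => ?_
  rw [← Finset.mul_sum]
  split_ifs with h
  · rw [hW, mul_zero]
  · simp

omit hQ1 in
theorem groupScore_pinv_groupInfo {q : X → ℝ} (hne : Q i ≠ q) (x : Fin n → ℝ) :
    groupScore Q W (pinv (groupInfo Q W i (Q i)) *ᵥ x) q = 0 := by
  rw [← groupInfo_mulVec_eq_zero_iff W i hQ, Matrix.mulVec_mulVec,
    mul_pinv_eq_zero (groupInfo_isSymm W i _) (groupInfo_mul_groupInfo W i hne),
    Matrix.zero_mulVec]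

include hW

theorem quadForm_tensorInfo_pinv_groupInfo {m : ℕ} (x : Fin n → ℝ) :
    (pinv (groupInfo Q W i (Q i)) *ᵥ x) ⬝ᵥ
        (tensorInfo Q W i m *ᵥ (pinv (groupInfo Q W i (Q i)) *ᵥ x)) =
      m * ((pinv (groupInfo Q W i (Q i)) *ᵥ x) ⬝ᵥ
        (groupInfo Q W i (Q i) *ᵥ (pinv (groupInfo Q W i (Q i)) *ᵥ x))) := by
  have hsingle : ∀ y : Fin m → X, ∑ q ∈ Finset.univ.image Q,
      tensorScore q (groupScore Q W (pinv (groupInfo Q W i (Q i)) *ᵥ x) q) m y =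
        tensorScore (Q i) (groupScore Q W (pinv (groupInfo Q W i (Q i)) *ᵥ x) (Q i)) m y :=
    fun y => Finset.sum_eq_single_of_mem _ (Finset.mem_image_of_mem Q (Finset.mem_univ i))
      fun q _ hne => by
        rw [groupScore_pinv_groupInfo i hQ hne.symm]
        simp [tensorScore]
  have hne := fun x => (hQ i x).ne'
  simp only [quadForm_tensorInfo, hsingle, quadForm_groupInfo, sq]
  rw [sum_tensorScore_mul_tensorScore _ hne hne, overlap_self_left hne, overlap_self_left hne,
    sum_groupScore hW, hQ1]
  ring

theorem dotProduct_pinv_groupInfo_le {m : ℕ} (hm : 2 ≤ m)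
    (hcross : crossTotal (Q i) (Finset.univ.image Q) m < 1) (x : Fin n → ℝ) :
    x ⬝ᵥ (pinv (groupInfo Q W i (Q i)) *ᵥ x) ≤
      x ⬝ᵥ (pinv ((m : ℝ)⁻¹ • tensorInfo Q W i m) *ᵥ x) := by
  have hm0 : (m : ℝ) ≠ 0 := by positivity
  refine dotProduct_pinv_le_dotProduct_pinv
    ((tensorInfo_posSemidef W i hQ m).smul (by positivity)) (groupInfo_posSemidef W i hQ _)
    (fun a ha => ?_) (Eq.le ?_)
  · refine (groupInfo_mulVec_eq_zero_iff W i hQ).2 (groupScore_eq_zero_of_decoupledInfo W i hQ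
      hcross hQ1 ((quadForm_decoupledInfo_le W i hQ hQ1 hm a).trans_eq ?_)
      (Finset.mem_image_of_mem Q (Finset.mem_univ i)))
    rw [ha, dotProduct_zero]
  · rw [Matrix.smul_mulVec, dotProduct_smul, smul_eq_mul,
      quadForm_tensorInfo_pinv_groupInfo i hQ hQ1 hW, inv_mul_cancel_left₀ hm0]

theorem tendsto_pinv_tensorInfo :
    Tendsto (fun m : ℕ => pinv ((m : ℝ)⁻¹ • tensorInfo Q W i m)) atTop
      (𝓝 (pinv (groupInfo Q W i (Q i)))) := by
  refine tendsto_matrix_of_tendsto_dotProduct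
    (fun m => isSymm_pinv (isSymm_of_posSemidef ((tensorInfo_posSemidef W i hQ m).smul
      (by positivity)))) (isSymm_pinv (groupInfo_isSymm W i _)) fun x => ?_
  have hupper : Tendsto (fun m => x ⬝ᵥ (pinv (decoupledInfo Q W i m) *ᵥ x)) atTop
      (𝓝 (x ⬝ᵥ (pinv (groupInfo Q W i (Q i)) *ᵥ x))) :=
    ((continuous_const.dotProduct (continuous_id.matrix_mulVec continuous_const)).tendsto _).comp
      (tendsto_pinv_decoupledInfo W i hQ hQ1)
  have hcross := (tendsto_crossTotal_image i hQ hQ1).eventually_lt_const one_pos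
  refine tendsto_of_tendsto_of_tendsto_of_le_of_le' tendsto_const_nhds hupper ?_ ?_
  · filter_upwards [hcross, eventually_ge_atTop 2] with m hm hm2
    exact dotProduct_pinv_groupInfo_le i hQ hQ1 hW hm2 hm x
  · filter_upwards [hcross, eventually_ge_atTop 2] with m hm hm2
    exact dotProduct_pinv_tensorInfo_le W i hQ hQ1 hm2 hm x

end GroupInfo

/-! ### Comparison of the two bounds -/

section LimitForm

variable {X : Type*} [Fintype X] {n : ℕ} {Q W : Fin n → X → ℝ} {i : Fin n}

theorem groupInfo_eq_smul_vecMulVec {r : Fin n → ℝ} (hzero : ∀ j, Q j ≠ Q i → r j = 0)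
    (hcoll : ∀ j, Q j = Q i → W j = r j • W i) :
    groupInfo Q W i (Q i) = overlap (Q i) (W i) (W i) • Matrix.vecMulVec r r := by
  have hgroup : ∀ j x, (if Q j = Q i then W j x else 0) = r j * W i x := fun j x => by
    split_ifs with h
    · rw [hcoll j h, Pi.smul_apply, smul_eq_mul]
    · rw [hzero j h, zero_mul]
  ext j k
  simp only [groupInfo, infoMatrix, hgroup, Matrix.of_apply, Matrix.smul_apply,
    Matrix.vecMulVec_apply, overlap, smul_eq_mul, Finset.sum_mul]
  exact Finset.sum_congr rfl fun x _ => by ring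

theorem groupInfo_eq_single (hne : ∀ j, j ≠ i → Q j ≠ Q i) :
    groupInfo Q W i (Q i) = Matrix.single i i (overlap (Q i) (W i) (W i)) := by
  rw [groupInfo_eq_smul_vecMulVec (r := Pi.single i 1)
    (fun j hj => Pi.single_eq_of_ne (fun h => hj (congrArg Q h)) _) fun j hj => ?_]
  · rw [← Matrix.single_eq_single_vecMulVec_single, Matrix.smul_single, smul_eq_mul, mul_one]
  · obtain rfl := not_imp_not.1 (hne j) hj
    simp

theorem dotProduct_pinv_groupInfo_eq {b : Fin n → ℝ}
    (hcoll : ∀ j, Q j = Q i → ∃ r : ℝ, W j = r • W i ∧ b j = r * b i) :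
    b ⬝ᵥ (pinv (groupInfo Q W i (Q i)) *ᵥ b) = b i ^ 2 / overlap (Q i) (W i) (W i) := by
  choose! s hW hb using hcoll
  set r : Fin n → ℝ := fun j => if Q j = Q i then s j else 0 with hr
  rw [groupInfo_eq_smul_vecMulVec (r := r) (fun j hj => if_neg hj) fun j hj => by
    simp only [hr, if_pos hj, hW j hj], pinv_smul, pinv_vecMulVec]
  rcases eq_or_ne (W i) 0 with hWi | hWi
  · simp [hWi, overlap]
  have hri : r i = 1 := by
    refine (if_pos rfl).trans (smul_left_injective ℝ hWi ?_)
    simpa using (hW i rfl).symm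
  have hrr : r ⬝ᵥ r ≠ 0 := dotProduct_self_eq_zero.not.2 fun h => by simp [h] at hri
  have hrb : r ⬝ᵥ b = b i * (r ⬝ᵥ r) := by
    simp only [dotProduct, Finset.mul_sum]
    refine Finset.sum_congr rfl fun j _ => ?_
    by_cases hj : Q j = Q i
    · simp only [hr, if_pos hj, hb j hj]
      ring
    · simp only [hr, if_neg hj]
      ring
  simp only [Matrix.smul_mulVec, Matrix.vecMulVec_mulVec, dotProduct_smul, dotProduct_comm b r, hrb,
    smul_eq_mul, MulOpposite.smul_eq_mul_unop, MulOpposite.unop_op]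
  field_simp

end LimitForm

section Asymptotics

theorem isLittleO_of_natCast_mul {u v : ℕ → ℝ}
    (h : (fun m : ℕ => (m : ℝ) * u m) =o[atTop] fun m : ℕ => (m : ℝ) * v m) :
    u =o[atTop] v := by
  have hcancel : ∀ f : ℕ → ℝ, (fun m : ℕ => (m : ℝ)⁻¹ * (m * f m)) =ᶠ[atTop] f := fun f => by
    filter_upwards [eventually_ne_atTop 0] with m hm
    exact inv_mul_cancel_left₀ (Nat.cast_ne_zero.2 hm) _
  exact ((isBigO_refl (fun m : ℕ => (m : ℝ)⁻¹) atTop).mul_isLittleO h).congr' (hcancel u)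
    (hcancel v)

theorem isBigO_sum_sum_mul {α ι : Type*} {l : Filter α} (s : Finset ι) {w : ι → ℝ}
    {u : ι → α → ℝ} (hw : ∀ i ∈ s, 0 ≤ w i) (hu : ∀ i ∈ s, ∀ a, 0 ≤ u i a)
    (h : ∀ i ∈ s, w i = 0 → u i =O[l] fun a => ∑ i ∈ s, w i * u i a) :
    (fun a => ∑ i ∈ s, u i a) =O[l] fun a => ∑ i ∈ s, w i * u i a := by
  refine IsBigO.fun_sum fun i hi => ?_
  rcases eq_or_ne (w i) 0 with h0 | h0
  · exact h i hi h0
  have hterm : u i =O[l] fun a => w i * u i a :=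
    (isBigO_refl (u i) l).const_mul_right h0
  refine hterm.trans <| isBigO_of_le _ fun a => ?_
  have hnonneg : ∀ j ∈ s, 0 ≤ w j * u j a := fun j hj => mul_nonneg (hw j hj) (hu j hj a)
  rw [Real.norm_of_nonneg (hnonneg i hi)]
  exact (Finset.single_le_sum hnonneg hi).trans (Real.le_norm_self _)

theorem isLittleO_dotProduct_mulVec {α ι : Type*} [Fintype ι] {l : Filter α}
    {M : α → Matrix ι ι ℝ} (hM : Tendsto M l (𝓝 0)) (b : α → ι → ℝ) :
    (fun a => b a ⬝ᵥ (M a *ᵥ b a)) =o[l] fun a => ∑ j, b a j ^ 2 := by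
  have hprod : ∀ j k, (fun a => b a j * b a k) =O[l] fun a => ∑ j, b a j ^ 2 := fun j k => by
    refine IsBigO.of_norm_le fun a => ?_
    have hle : ∀ j, b a j ^ 2 ≤ ∑ j, b a j ^ 2 := fun j =>
      Finset.single_le_sum (f := fun j => b a j ^ 2) (fun j _ => sq_nonneg _) (Finset.mem_univ j)
    rw [Real.norm_eq_abs, abs_le]
    constructor <;> nlinarith [hle j, hle k, sq_nonneg (b a j + b a k), sq_nonneg (b a j - b a k)]
  have hentry : ∀ j k, (fun a => M a j k) =o[l] fun _ => (1 : ℝ) := fun j k =>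
    (isLittleO_one_iff ℝ).2 ((continuous_id.matrix_elem j k).tendsto' 0 0 rfl |>.comp hM)
  simp only [dotProduct, Matrix.mulVec, Finset.mul_sum]
  refine IsLittleO.fun_sum fun j _ => IsLittleO.fun_sum fun k _ => ?_
  exact ((hentry j k).mul_isBigO (hprod j k)).congr (fun a => by ring) fun a => one_mul _

end Asymptotics

section Comparison

variable {X : Type*} [Fintype X] {n : ℕ} {p : X → ℝ → ℝ} {θ : Fin n → ℝ}
  (hpos : ∀ i x, 0 < p x (θ i)) (hdiff : ∀ i x, DifferentiableAt ℝ (p x) (θ i))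
  (hsum : ∀ i, ∑ x, p x (θ i) = 1) (hderiv : ∀ i, ∑ x, deriv (p x) (θ i) = 0)

/-- The information matrix at `θ i` of a single repetition, restricted to the indices `j` for
which `θ j` has the same distribution as `θ i`. -/
noncomputable def restrictedInfo (p : X → ℝ → ℝ) (θ : Fin n → ℝ) (i : Fin n) :
    Matrix (Fin n) (Fin n) ℝ :=
  groupInfo (fun j x => p x (θ j)) (fun j x => deriv (p x) (θ j)) i fun x => p x (θ i)

include hpos hdiff hderiv

theorem biasRep_eq_biasRep_self (est : EstimatorSeq X) (i j : Fin n) (m : ℕ) :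
    biasRep p θ est i j m = biasRep p θ est j j m := by
  simp only [biasRep_eq_sum_mul hpos hdiff (hderiv j)]

theorem fgRep_eq (w : Fin n → ℝ) (est : EstimatorSeq X) (m : ℕ) :
    fgRep w p θ est m = ∑ i, w i * ((fun j => biasRep p θ est j j m) ⬝ᵥ
      (pinv (infoRep p θ i m) *ᵥ fun j => biasRep p θ est j j m)) := by
  simp only [fgRep, fullyGlobalBound]
  refine Finset.sum_congr rfl fun i _ => ?_
  rw [← funext fun j => biasRep_eq_biasRep_self hpos hdiff hderiv est i j m]
  rfl

include hsum

theorem gcrRep_eq (w : Fin n → ℝ) (est : EstimatorSeq X) (m : ℕ) :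
    gcrRep w p θ est m =
      ∑ i, w i * (biasRep p θ est i i m ^ 2 / (m * fisherInfo p (θ i))) := by
  simp only [← infoRep_self hpos hdiff (hsum _) (hderiv _)]
  rfl

theorem mul_gcrRep (w : Fin n → ℝ) (est : EstimatorSeq X) {m : ℕ} (hm : m ≠ 0) :
    m * gcrRep w p θ est m = ∑ i, w i * (biasRep p θ est i i m ^ 2 / fisherInfo p (θ i)) := by
  have hm' : (m : ℝ) ≠ 0 := Nat.cast_ne_zero.2 hm
  rw [gcrRep_eq hpos hdiff hsum hderiv, Finset.mul_sum]
  refine Finset.sum_congr rfl fun i _ => ?_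
  rw [mul_left_comm, ← mul_div_assoc, mul_div_mul_left _ _ hm']

theorem tendsto_pinv_infoRep_restrictedInfo (i : Fin n) :
    Tendsto (fun m : ℕ => pinv ((m : ℝ)⁻¹ • infoRep p θ i m)) atTop
      (𝓝 (pinv (restrictedInfo p θ i))) := by
  have hinfo : ∀ m, infoRep p θ i m =
      tensorInfo (fun j x => p x (θ j)) (fun j x => deriv (p x) (θ j)) i m := fun m => by
    rw [infoRep, score_m_eq_tensorScore hpos hdiff]
    rfl
  simp only [hinfo]
  exact tendsto_pinv_tensorInfo i hpos hsum hderiv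

theorem tendsto_pinv_infoRep {i : Fin n} (hne : ∀ j, j ≠ i → ∃ x, p x (θ j) ≠ p x (θ i)) :
    Tendsto (fun m : ℕ => pinv ((m : ℝ)⁻¹ • infoRep p θ i m)) atTop
      (𝓝 (Matrix.single i i (1 / infoRep p θ i 1 i i))) := by
  have hlim : pinv (restrictedInfo p θ i) = Matrix.single i i (1 / infoRep p θ i 1 i i) := by
    rw [restrictedInfo, groupInfo_eq_single (Q := fun j x => p x (θ j)) fun j hj =>
      Function.ne_iff.2 (hne j hj), pinv_single, infoRep_one hpos hdiff, one_div, overlap]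
  exact hlim ▸ tendsto_pinv_infoRep_restrictedInfo hpos hdiff hsum hderiv i

omit hsum in
theorem biasRep_sq_eq (est : EstimatorSeq X) (i : Fin n) (m : ℕ) :
    biasRep p θ est i i m ^ 2 =
      fisherInfo p (θ i) * (biasRep p θ est i i m ^ 2 / fisherInfo p (θ i)) := by
  refine (mul_div_cancel_of_imp' fun hF => ?_).symm
  have hscore : ∀ x, deriv (p x) (θ i) = 0 := fun x => by
    have hterm := (Finset.sum_eq_zero_iff_of_nonneg fun x _ =>
      div_nonneg (sq_nonneg _) (hpos i x).le).1 hF x (Finset.mem_univ x)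
    simpa [(hpos i x).ne'] using hterm
  simp [biasRep_eq_sum_mul hpos hdiff (hderiv i), score_m_eq_tensorScore hpos hdiff, tensorScore,
    hscore]

variable (hcoll : ∀ i j, (∀ x, p x (θ j) = p x (θ i)) →
  ∃ r : ℝ, ∀ x, deriv (p x) (θ j) = r * deriv (p x) (θ i))
include hcoll

omit hsum in
theorem dotProduct_pinv_restrictedInfo (est : EstimatorSeq X) (i : Fin n) (m : ℕ) :
    (fun j => biasRep p θ est j j m) ⬝ᵥ
        (pinv (restrictedInfo p θ i) *ᵥ fun j => biasRep p θ est j j m) =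
      biasRep p θ est i i m ^ 2 / fisherInfo p (θ i) := by
  have hfisher : fisherInfo p (θ i) = overlap (fun x => p x (θ i))
      (fun x => deriv (p x) (θ i)) fun x => deriv (p x) (θ i) := by
    simp only [fisherInfo, overlap, sq]
  rw [hfisher]
  refine dotProduct_pinv_groupInfo_eq fun j hj => ?_
  obtain ⟨r, hr⟩ := hcoll i j (congrFun hj)
  refine ⟨r, funext hr, ?_⟩
  simp only [biasRep_eq_sum_mul hpos hdiff (hderiv _), score_m_eq_tensorScore hpos hdiff,
    Finset.mul_sum]
  refine Finset.sum_congr rfl fun x _ => ?_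
  simp only [tensorScore, hr, congrFun hj, mul_div_assoc, ← Finset.mul_sum]
  ring

theorem isLittleO_mul_fgRep_sub_gcrRep (w : Fin n → ℝ) (est : EstimatorSeq X) :
    (fun m : ℕ => (m : ℝ) * (fgRep w p θ est m - gcrRep w p θ est m)) =o[atTop]
      fun m => ∑ j, biasRep p θ est j j m ^ 2 := by
  have hlim : ∀ i, Tendsto (fun m : ℕ => w i • (pinv ((m : ℝ)⁻¹ • infoRep p θ i m) -
      pinv (restrictedInfo p θ i))) atTop (𝓝 0) := fun i => by
    simpa using ((tendsto_pinv_infoRep_restrictedInfo hpos hdiff hsum hderiv i).sub_const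
      (pinv (restrictedInfo p θ i))).const_smul (w i)
  refine (IsLittleO.fun_sum fun i (_ : i ∈ Finset.univ) => isLittleO_dotProduct_mulVec (hlim i)
    fun m j => biasRep p θ est j j m).congr' ?_ EventuallyEq.rfl
  filter_upwards [eventually_ne_atTop 0] with m hm
  rw [mul_sub, mul_gcrRep hpos hdiff hsum hderiv w est hm, fgRep_eq hpos hdiff hderiv,
    Finset.mul_sum, ← Finset.sum_sub_distrib]
  refine Finset.sum_congr rfl fun i _ => ?_
  rw [← dotProduct_pinv_restrictedInfo hpos hdiff hderiv hcoll, pinv_smul, inv_inv]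
  simp only [Matrix.smul_mulVec, Matrix.sub_mulVec, dotProduct_smul, dotProduct_sub, smul_eq_mul]
  ring

theorem tendsto_mul_fgRep_sub_gcrRep (w : Fin n → ℝ) (est : EstimatorSeq X)
    (hbias : ∀ j, biasRep p θ est j j =O[atTop] fun _ => (1 : ℝ)) :
    Tendsto (fun m : ℕ => (m : ℝ) * (fgRep w p θ est m - gcrRep w p θ est m)) atTop (𝓝 0) := by
  refine (isLittleO_one_iff ℝ).1 ((isLittleO_mul_fgRep_sub_gcrRep hpos hdiff hsum hderiv hcoll w
    est).trans_isBigO (IsBigO.fun_sum fun j _ => ?_))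
  simpa using (hbias j).pow 2

theorem fgRep_isEquivalent_gcrRep {w : Fin n → ℝ} (hw : ∀ i, 0 ≤ w i) (est : EstimatorSeq X)
    (hbias : ∀ j, w j = 0 → (fun m => biasRep p θ est j j m ^ 2) =O[atTop]
      fun m => ∑ i, w i * biasRep p θ est i i m ^ 2) :
    fgRep w p θ est ~[atTop] gcrRep w p θ est := by
  have hweighted := isBigO_sum_sum_mul Finset.univ (fun i _ => hw i)
    (u := fun i m => biasRep p θ est i i m ^ 2) (fun i _ m => sq_nonneg _) fun i _ => hbias i
  have hfisher : ∀ i, 0 ≤ fisherInfo p (θ i) := fun i =>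
    Finset.sum_nonneg fun x _ => div_nonneg (sq_nonneg _) (hpos i x).le
  have hgcr : (fun m => ∑ i, w i * biasRep p θ est i i m ^ 2) =O[atTop]
      fun m : ℕ => (m : ℝ) * gcrRep w p θ est m := by
    refine (IsBigO.sum_congr
      (B := fun i m => w i * (biasRep p θ est i i m ^ 2 / fisherInfo p (θ i)))
      fun i _ => ?_).congr' EventuallyEq.rfl ?_
    · refine IsBigO.of_bound (fisherInfo p (θ i)) (Eventually.of_forall fun m => Eq.le ?_)
      conv_lhs => rw [biasRep_sq_eq hpos hdiff hderiv, mul_left_comm, norm_mul,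
        Real.norm_of_nonneg (hfisher i)]
    · filter_upwards [eventually_ne_atTop 0] with m hm
      rw [mul_gcrRep hpos hdiff hsum hderiv w est hm]
      exact Finset.sum_congr rfl fun i _ =>
        Real.norm_of_nonneg (mul_nonneg (hw i) (div_nonneg (sq_nonneg _) (hfisher i)))
  exact isLittleO_of_natCast_mul ((isLittleO_mul_fgRep_sub_gcrRep hpos hdiff hsum hderiv hcoll w
    est).trans_isBigO (hweighted.trans hgcr))

end Comparison

/-! ### Deviations of the empirical distribution -/

section Empirical

variable {X : Type*}

open Classical in
/-- The deviation of the empirical frequency of `z` in the data `x` from `P z`. -/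
noncomputable def empDev (P : X → ℝ) (m : ℕ) (x : Fin m → X) (z : X) : ℝ :=
  (∑ r, ((if x r = z then 1 else 0) - P z)) / m

theorem empDev_pow (P : X → ℝ) [DecidableEq X] (m k : ℕ) (x : Fin m → X) (z : X) :
    empDev P m x z ^ k = ((m : ℝ) ^ k)⁻¹ * (∑ r, ((if x r = z then 1 else 0) - P z)) ^ k := by
  rw [empDev, div_pow, div_eq_inv_mul]
  congr!

variable [Fintype X]

theorem sum_sub_mean_eq_mul_sum_empDev (P : X → ℝ) (m : ℕ) (x : Fin m → X) (f : X → ℝ) :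
    ∑ r, (f (x r) - ∑ z, P z * f z) = m * ∑ z, empDev P m x z * f z := by
  classical
  rcases eq_or_ne m 0 with rfl | hm
  · simp
  have hcount : ∀ z, m * empDev P m x z = ∑ r, ((if x r = z then 1 else 0) - P z) := fun z => by
    rw [empDev, mul_div_cancel₀ _ (Nat.cast_ne_zero.2 hm)]
  simp only [Finset.mul_sum, ← mul_assoc, hcount, Finset.sum_mul]
  rw [Finset.sum_comm]
  simp [sub_mul]

variable {P : X → ℝ}

theorem abs_indicator_sub_le_one (hP : ∀ x, 0 ≤ P x) (hP1 : ∑ x, P x = 1) (z : X) (c : Prop)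
    [Decidable c] : |(if c then (1 : ℝ) else 0) - P z| ≤ 1 := by
  have hz : P z ≤ 1 := hP1 ▸ Finset.single_le_sum (fun y _ => hP y) (Finset.mem_univ z)
  rw [abs_le]
  split_ifs <;> constructor <;> linarith [hP z]

theorem sum_mul_indicator_sub [DecidableEq X] (hP1 : ∑ x, P x = 1) (z : X) :
    ∑ a, P a * ((if a = z then 1 else 0) - P z) = 0 := by
  simp [mul_sub, ← Finset.sum_mul, hP1]

theorem mul_iidSum_empDev_sq_le (hP : ∀ x, 0 ≤ P x) (hP1 : ∑ x, P x = 1) (m : ℕ) (z : X) :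
    m * iidSum P m (fun x => empDev P m x z ^ 2) ≤ 1 := by
  classical
  have hvar : ∑ a, P a * ((if a = z then 1 else 0) - P z) ^ 2 ≤ 1 := by
    refine (Finset.sum_le_sum fun a _ => mul_le_of_le_one_right (hP a) ?_).trans_eq hP1
    exact (sq_le_one_iff_abs_le_one _).2 (abs_indicator_sub_le_one hP hP1 z _)
  rcases eq_or_ne m 0 with rfl | hm
  · simp
  simp only [empDev_pow, iidSum_const_mul,
    iidSum_sq_of_centered hP1 (sum_mul_indicator_sub hP1 z) m]
  refine le_of_eq_of_le ?_ hvar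
  field_simp

theorem mul_iidSum_empDev_pow_four_le (hP : ∀ x, 0 ≤ P x) (hP1 : ∑ x, P x = 1) (m : ℕ) (z : X) :
    m * iidSum P m (fun x => empDev P m x z ^ 4) ≤ 3 / m := by
  classical
  rcases eq_or_ne m 0 with rfl | hm
  · simp
  have hfour := iidSum_pow_four_le hP hP1 (sum_mul_indicator_sub hP1 z)
    (fun a => abs_indicator_sub_le_one hP hP1 z _) m
  simp only [empDev_pow, iidSum_const_mul]
  calc (m : ℝ) * (((m : ℝ) ^ 4)⁻¹ * iidSum P m _)
      ≤ m * (((m : ℝ) ^ 4)⁻¹ * (3 * (m : ℝ) ^ 2)) := by gcongr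
    _ = 3 / m := by field_simp

theorem iidSum_sq_nonneg (hP : ∀ x, 0 ≤ P x) {m : ℕ} (e : (Fin m → X) → ℝ) :
    0 ≤ iidSum P m (fun x => e x ^ 2) :=
  Finset.sum_nonneg fun _ _ => mul_nonneg (Finset.prod_nonneg fun _ _ => hP _) (sq_nonneg _)

/-- Where some deviation exceeds `η`, the fourth powers of the deviations outweigh `D ^ 2`. -/
theorem sq_le_of_sq_le_empDev {m : ℕ} {x : Fin m → X} {e D ε η : ℝ} (hε : 0 ≤ ε) (hη : 0 < η)
    (hD : |e| ≤ D) (he : (∀ z, |empDev P m x z| ≤ η) → e ^ 2 ≤ ε * ∑ z, empDev P m x z ^ 2) :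
    e ^ 2 ≤ ε * ∑ z, empDev P m x z ^ 2 + D ^ 2 / η ^ 4 * ∑ z, empDev P m x z ^ 4 := by
  have h2 : 0 ≤ ε * ∑ z, empDev P m x z ^ 2 := by positivity
  have h4 : ∀ z, 0 ≤ empDev P m x z ^ 4 := fun z => by positivity
  by_cases hsmall : ∀ z, |empDev P m x z| ≤ η
  · exact (he hsmall).trans
      (le_add_of_nonneg_right (mul_nonneg (by positivity) (Finset.sum_nonneg fun z _ => h4 z)))
  · push Not at hsmall
    obtain ⟨z, hz⟩ := hsmall
    have hlarge : η ^ 4 ≤ ∑ z, empDev P m x z ^ 4 := calc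
      η ^ 4 ≤ |empDev P m x z| ^ 4 := by gcongr
      _ = empDev P m x z ^ 4 := Even.pow_abs (by decide) _
      _ ≤ _ := Finset.single_le_sum (fun z _ => h4 z) (Finset.mem_univ z)
    calc e ^ 2 ≤ D ^ 2 := by rw [← sq_abs]; gcongr
      _ = D ^ 2 / η ^ 4 * η ^ 4 := by field_simp
      _ ≤ D ^ 2 / η ^ 4 * ∑ z, empDev P m x z ^ 4 := by gcongr
      _ ≤ _ := le_add_of_nonneg_left h2

theorem mul_iidSum_sq_le (hP : ∀ x, 0 ≤ P x) (hP1 : ∑ x, P x = 1) {m : ℕ}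
    {e : (Fin m → X) → ℝ} {D ε η : ℝ} (hε : 0 ≤ ε) (hη : 0 < η) (hD : ∀ x, |e x| ≤ D)
    (he : ∀ x, (∀ z, |empDev P m x z| ≤ η) → e x ^ 2 ≤ ε * ∑ z, empDev P m x z ^ 2) :
    m * iidSum P m (fun x => e x ^ 2) ≤
      ε * Fintype.card X + D ^ 2 / η ^ 4 * (Fintype.card X * (3 / m)) := by
  have hsum : ∀ (k : ℕ) (B : ℝ), (∀ z, m * iidSum P m (fun x => empDev P m x z ^ k) ≤ B) →
      m * ∑ z, iidSum P m (fun x => empDev P m x z ^ k) ≤ Fintype.card X * B := fun k B hB => by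
    rw [Finset.mul_sum, ← nsmul_eq_mul]
    exact Finset.sum_le_card_nsmul _ _ _ fun z _ => hB z
  calc m * iidSum P m (fun x => e x ^ 2)
      ≤ m * iidSum P m (fun x => ε * ∑ z, empDev P m x z ^ 2 +
          D ^ 2 / η ^ 4 * ∑ z, empDev P m x z ^ 4) :=
        mul_le_mul_of_nonneg_left
          (iidSum_mono hP fun x => sq_le_of_sq_le_empDev hε hη (hD x) (he x)) m.cast_nonneg
    _ = ε * (m * ∑ z, iidSum P m (fun x => empDev P m x z ^ 2)) +
          D ^ 2 / η ^ 4 * (m * ∑ z, iidSum P m (fun x => empDev P m x z ^ 4)) := by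
        simp only [iidSum_add, iidSum_const_mul, iidSum_finsetSum]
        ring
    _ ≤ ε * (Fintype.card X * 1) + D ^ 2 / η ^ 4 * (Fintype.card X * (3 / m)) := by
        gcongr ε * ?_ + D ^ 2 / η ^ 4 * ?_
        · exact hsum 2 1 (mul_iidSum_empDev_sq_le hP hP1 m)
        · exact hsum 4 _ (mul_iidSum_empDev_pow_four_le hP hP1 m)
    _ = _ := by rw [mul_one]

theorem tendsto_mul_iidSum_sq (hP : ∀ x, 0 ≤ P x) (hP1 : ∑ x, P x = 1)
    {e : (m : ℕ) → (Fin m → X) → ℝ} {D : ℝ} (hD : ∀ m x, |e m x| ≤ D)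
    (he : ∀ ε > 0, ∃ η > 0, ∀ m ≠ 0, ∀ x : Fin m → X, (∀ z, |empDev P m x z| ≤ η) →
      e m x ^ 2 ≤ ε * ∑ z, empDev P m x z ^ 2) :
    Tendsto (fun m : ℕ => m * iidSum P m (fun x => e m x ^ 2)) atTop (𝓝 0) := by
  refine tendsto_order.2 ⟨fun a ha => Eventually.of_forall fun m => ha.trans_le
    (mul_nonneg m.cast_nonneg (iidSum_sq_nonneg hP _)), fun a ha => ?_⟩
  have hsmall : 0 < a / (2 * (Fintype.card X + 1)) := by positivity
  obtain ⟨η, hη, hη'⟩ := he _ hsmall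
  have htail : Tendsto (fun m : ℕ => D ^ 2 / η ^ 4 * (Fintype.card X * (3 / (m : ℝ)))) atTop
      (𝓝 0) := by
    simpa using ((tendsto_const_div_atTop_nhds_zero_nat (3 : ℝ)).const_mul _).const_mul _
  have hhead : a / (2 * (Fintype.card X + 1)) * Fintype.card X ≤ a / 2 := by
    rw [div_mul_eq_mul_div, div_le_div_iff₀ (by positivity) two_pos]
    nlinarith
  filter_upwards [htail.eventually_lt_const (half_pos ha), eventually_ne_atTop 0] with m hm hm0
  linarith [mul_iidSum_sq_le hP hP1 hsmall.le hη (hD m) (hη' m hm0)]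

end Empirical

/-! ### Asymptotically linear estimators -/

section AsymptoticallyLinear

variable {X : Type*} [Fintype X]

/-- The variance of `F` under `m` independent repetitions, for a probability vector `P`. -/
def iidVar (P : X → ℝ) (m : ℕ) (F : (Fin m → X) → ℝ) : ℝ :=
  iidSum P m fun x => (F x - iidSum P m F) ^ 2

/-- `T` is asymptotically linear at `P` around `c` with influence function `φ`: it is the mean of
`c + φ` over the data up to an error whose second moment is `o(1 / m)`. -/
def IsAsymptoticallyLinear (P : X → ℝ) (c : ℝ) (φ : X → ℝ) (T : EstimatorSeq X) : Prop :=
  Tendsto (fun m : ℕ => m * iidSum P m fun x => (T m x - (c + (∑ r, φ (x r)) / m)) ^ 2) atTop (𝓝 0)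

variable {P : X → ℝ}

theorem iidVar_eq_sub (hP1 : ∑ x, P x = 1) {m : ℕ} (F : (Fin m → X) → ℝ) (c : ℝ) :
    iidVar P m F = iidSum P m (fun x => (F x - c) ^ 2) - iidSum P m (fun x => F x - c) ^ 2 := by
  set μ := iidSum P m F with hμ
  have hexpand : ∀ x, (F x - μ) ^ 2 = (F x - c) ^ 2 + 2 * (c - μ) * F x + (μ ^ 2 - c ^ 2) :=
    fun x => by ring
  have hmean : iidSum P m (fun x => F x - c) = μ - c := by
    simp only [sub_eq_add_neg, iidSum_add, iidSum_const, hP1, one_pow, mul_one, hμ]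
  simp only [iidVar, ← hμ, hexpand, iidSum_add, iidSum_const_mul, iidSum_const, hP1, hmean]
  ring

theorem sq_iidSum_mul_le (hP : ∀ x, 0 ≤ P x) {m : ℕ} (F G : (Fin m → X) → ℝ) :
    iidSum P m (fun x => F x * G x) ^ 2 ≤
      iidSum P m (fun x => F x ^ 2) * iidSum P m (fun x => G x ^ 2) := by
  have hweight : ∀ x : Fin m → X, 0 ≤ ∏ r, P (x r) := fun x => Finset.prod_nonneg fun r _ => hP _
  refine Finset.sum_sq_le_sum_mul_sum_of_sq_le_mul _
    (fun x _ => mul_nonneg (hweight x) (sq_nonneg _))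
    (fun x _ => mul_nonneg (hweight x) (sq_nonneg _)) fun x _ => le_of_eq ?_
  ring

theorem sq_iidSum_le (hP : ∀ x, 0 ≤ P x) (hP1 : ∑ x, P x = 1) {m : ℕ} (F : (Fin m → X) → ℝ) :
    iidSum P m F ^ 2 ≤ iidSum P m (fun x => F x ^ 2) := by
  simpa [iidSum_const, hP1] using sq_iidSum_mul_le hP (fun _ => 1) F

theorem tendsto_iidSum_sum_mul (hP : ∀ x, 0 ≤ P x) (hP1 : ∑ x, P x = 1) {f : X → ℝ}
    (hf : ∑ x, P x * f x = 0) {e : (m : ℕ) → (Fin m → X) → ℝ}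
    (he : Tendsto (fun m : ℕ => m * iidSum P m fun x => e m x ^ 2) atTop (𝓝 0)) :
    Tendsto (fun m => iidSum P m fun x => (∑ r, f (x r)) * e m x) atTop (𝓝 0) := by
  refine squeeze_zero_norm (a := fun m : ℕ =>
    √((∑ x, P x * f x ^ 2) * (m * iidSum P m fun x => e m x ^ 2))) (fun m => ?_) ?_
  · refine Real.abs_le_sqrt ((sq_iidSum_mul_le hP _ _).trans_eq ?_)
    rw [iidSum_sq_of_centered hP1 hf]
    ring
  · simpa using (he.const_mul (∑ x, P x * f x ^ 2)).sqrt

namespace IsAsymptoticallyLinear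

variable {c : ℝ} {φ : X → ℝ} {T : EstimatorSeq X}

theorem tendsto_iidSum_sum_mul (hT : IsAsymptoticallyLinear P c φ T) (hP : ∀ x, 0 ≤ P x)
    (hP1 : ∑ x, P x = 1) {f : X → ℝ} (hf : ∑ x, P x * f x = 0) :
    Tendsto (fun m => iidSum P m fun x => (∑ r, f (x r)) * T m x) atTop
      (𝓝 (∑ x, P x * (f x * φ x))) := by
  set e : (m : ℕ) → (Fin m → X) → ℝ := fun m x => T m x - (c + (∑ r, φ (x r)) / m) with he
  have herror := _root_.tendsto_iidSum_sum_mul hP hP1 hf hT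
  rw [← add_zero (∑ x, _)]
  refine (herror.const_add _).congr' ?_
  filter_upwards [eventually_ne_atTop 0] with m hm
  have hsplit : ∀ x, (∑ r, f (x r)) * T m x = c * (∑ r, f (x r)) +
      (m : ℝ)⁻¹ * ((∑ r, f (x r)) * ∑ r, φ (x r)) + (∑ r, f (x r)) * e m x := fun x => by
    rw [he]
    ring
  have hmain : iidSum P m (fun x => (∑ r, f (x r)) * ∑ r, φ (x r)) =
      m * ∑ x, P x * (f x * φ x) := by
    simp [iidSum_sum_mul_sum, hf, hP1]
  simp only [hsplit, iidSum_add, iidSum_const_mul, iidSum_sum, hmain, hf, mul_zero, zero_add]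
  rw [inv_mul_cancel_left₀ (Nat.cast_ne_zero.2 hm)]

theorem tendsto_mul_iidVar (hT : IsAsymptoticallyLinear P c φ T) (hP : ∀ x, 0 ≤ P x)
    (hP1 : ∑ x, P x = 1) (hφ : ∑ x, P x * φ x = 0) :
    Tendsto (fun m : ℕ => m * iidVar P m (T m)) atTop (𝓝 (∑ x, P x * φ x ^ 2)) := by
  set e : (m : ℕ) → (Fin m → X) → ℝ := fun m x => T m x - (c + (∑ r, φ (x r)) / m) with he
  have hcross := _root_.tendsto_iidSum_sum_mul hP hP1 hφ hT
  have hmean : Tendsto (fun m : ℕ => m * iidSum P m (e m) ^ 2) atTop (𝓝 0) :=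
    squeeze_zero (fun m => by positivity)
      (fun m => mul_le_mul_of_nonneg_left (sq_iidSum_le hP hP1 (e m)) m.cast_nonneg) hT
  have hlim := (((hcross.const_mul 2).const_add (∑ x, P x * φ x ^ 2)).add hT).sub hmean
  simp only [mul_zero, add_zero, sub_zero] at hlim
  refine hlim.congr' ?_
  filter_upwards [eventually_ne_atTop 0] with m hm
  have hsplit : ∀ x, T m x - c = (m : ℝ)⁻¹ * (∑ r, φ (x r)) + e m x := fun x => by
    rw [he]
    ring
  have hfirst : iidSum P m (fun x => T m x - c) = iidSum P m (e m) := by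
    simp only [hsplit, iidSum_add, iidSum_const_mul, iidSum_sum, hφ, mul_zero, zero_add]
  have hsecond : iidSum P m (fun x => (T m x - c) ^ 2) =
      ((m : ℝ)⁻¹) ^ 2 * (m * ∑ x, P x * φ x ^ 2) +
        2 * (m : ℝ)⁻¹ * iidSum P m (fun x => (∑ r, φ (x r)) * e m x) +
          iidSum P m fun x => e m x ^ 2 := by
    have hexpand : ∀ S r : ℝ, ((m : ℝ)⁻¹ * S + r) ^ 2 =
        ((m : ℝ)⁻¹) ^ 2 * S ^ 2 + 2 * (m : ℝ)⁻¹ * (S * r) + r ^ 2 := fun S r => by ring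
    simp only [hsplit, hexpand, iidSum_add, iidSum_const_mul, iidSum_sq_of_centered hP1 hφ]
  have hm0 : (m : ℝ) * (m : ℝ)⁻¹ = 1 := mul_inv_cancel₀ (Nat.cast_ne_zero.2 hm)
  rw [iidVar_eq_sub hP1 _ c, hfirst, hsecond]
  linear_combination (-(1 + m * (m : ℝ)⁻¹) * ∑ x, P x * φ x ^ 2 -
    2 * iidSum P m fun x => (∑ r, φ (x r)) * e m x) * hm0

end IsAsymptoticallyLinear

theorem abs_sum_div_le (m : ℕ) (f : X → ℝ) (x : Fin m → X) :
    |(∑ r, f (x r)) / m| ≤ ∑ z, |f z| := by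
  rw [abs_div, Nat.abs_cast]
  refine div_le_of_le_mul₀ m.cast_nonneg (by positivity) ?_
  calc |∑ r, f (x r)| ≤ ∑ r, |f (x r)| := Finset.abs_sum_le_sum_abs _ _
    _ ≤ ∑ _r : Fin m, ∑ z, |f z| := Finset.sum_le_sum fun r _ =>
        Finset.single_le_sum (f := fun z => |f z|) (fun z _ => abs_nonneg _) (Finset.mem_univ _)
    _ = (∑ z, |f z|) * m := by simp [mul_comm]

theorem isAsymptoticallyLinear_of_empDev (hP : ∀ x, 0 ≤ P x) (hP1 : ∑ x, P x = 1) {c : ℝ}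
    {φ : X → ℝ} (hφ : ∑ x, P x * φ x = 0) {T : EstimatorSeq X} {D : ℝ} (hD : ∀ m x, |T m x| ≤ D)
    (hT : ∀ ε > 0, ∃ η > 0, ∀ m ≠ 0, ∀ x : Fin m → X, (∀ z, |empDev P m x z| ≤ η) →
      |T m x - (c + ∑ z, empDev P m x z * φ z)| ≤ ε * ∑ z, |empDev P m x z|) :
    IsAsymptoticallyLinear P c φ T := by
  refine tendsto_mul_iidSum_sq hP hP1 (D := D + (|c| + ∑ z, |φ z|)) (fun m x => ?_)
    fun ε hε => ?_
  · exact (abs_sub _ _).trans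
      (add_le_add (hD m x) ((abs_add_le _ _).trans (add_le_add_right (abs_sum_div_le m φ x) _)))
  · have hκ : 0 < ε / (Fintype.card X + 1) := by positivity
    obtain ⟨η, hη, hbound⟩ := hT _ (Real.sqrt_pos.2 hκ)
    refine ⟨η, hη, fun m hm x hx => ?_⟩
    have hmean : (∑ r, φ (x r)) / m = ∑ z, empDev P m x z * φ z := by
      have h := sum_sub_mean_eq_mul_sum_empDev P m x φ
      simp only [hφ, sub_zero] at h
      rw [h, mul_div_cancel_left₀ _ (Nat.cast_ne_zero.2 hm)]
    have hcard : (∑ z, |empDev P m x z|) ^ 2 ≤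
        Fintype.card X * ∑ z, empDev P m x z ^ 2 := by
      simpa [sq_abs] using sq_sum_le_card_mul_sum_sq (s := Finset.univ)
        (f := fun z => |empDev P m x z|)
    calc (T m x - (c + (∑ r, φ (x r)) / m)) ^ 2
        ≤ (√(ε / (Fintype.card X + 1)) * ∑ z, |empDev P m x z|) ^ 2 := by
          rw [hmean, ← sq_abs]
          exact pow_le_pow_left₀ (abs_nonneg _) (hbound m hm x hx) 2
      _ ≤ ε / (Fintype.card X + 1) * ((Fintype.card X + 1) * ∑ z, empDev P m x z ^ 2) := by
          rw [mul_pow, Real.sq_sqrt hκ.le]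
          gcongr
          refine hcard.trans ?_
          gcongr
          exact le_add_of_nonneg_right zero_le_one
      _ = ε * ∑ z, empDev P m x z ^ 2 := by field_simp

end AsymptoticallyLinear

/-! ### Maximum-likelihood estimators -/

section MaximumLikelihood

variable {X : Type*} {p : X → ℝ → ℝ}

theorem prod_lt_one_of_sum_lt_card {ι : Type*} [Fintype ι] {f : ι → ℝ} (hf : ∀ r, 0 ≤ f r)
    (hsum : ∑ r, f r < Fintype.card ι) : ∏ r, f r < 1 := calc
  ∏ r, f r ≤ ∏ r, Real.exp (f r - 1) :=
    Finset.prod_le_prod (fun r _ => hf r) fun r _ => by linarith [Real.add_one_le_exp (f r - 1)]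
  _ = Real.exp (∑ r, (f r - 1)) := (Real.exp_sum _ _).symm
  _ < 1 := by simpa [Finset.sum_sub_distrib] using hsum

theorem jointProb_eq_prod_sq_mul {s t : ℝ} (ht : ∀ x, 0 ≤ p x t) (hs : ∀ x, 0 < p x s) (m : ℕ)
    (x : Fin m → X) :
    jointProb p m x t = (∏ r, √(p (x r) t) / √(p (x r) s)) ^ 2 * jointProb p m x s := by
  rw [jointProb, jointProb, ← Finset.prod_pow, ← Finset.prod_mul_distrib]
  refine Finset.prod_congr rfl fun r _ => ?_
  rw [div_pow, Real.sq_sqrt (ht _), Real.sq_sqrt (hs _).le, div_mul_cancel₀ _ (hs _).ne']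

theorem jointProb_lt_of_sum_sqrt_lt {s t : ℝ} (ht : ∀ x, 0 ≤ p x t) (hs : ∀ x, 0 < p x s) {m : ℕ}
    {x : Fin m → X} (hlt : ∑ r, √(p (x r) t) / √(p (x r) s) < m) :
    jointProb p m x t < jointProb p m x s := by
  have hratio : ∀ r, 0 ≤ √(p (x r) t) / √(p (x r) s) := fun r => by positivity
  rw [jointProb_eq_prod_sq_mul ht hs]
  refine mul_lt_of_lt_one_left (Finset.prod_pos fun r _ => hs (x r))
    (pow_lt_one₀ (Finset.prod_nonneg fun r _ => hratio r) ?_ two_ne_zero)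
  exact prod_lt_one_of_sum_lt_card hratio (by simpa using hlt)

variable [Fintype X]

theorem sum_sqrt_mul_sqrt_lt_one {P Q : X → ℝ} (hP : ∀ x, 0 ≤ P x) (hQ : ∀ x, 0 ≤ Q x)
    (hP1 : ∑ x, P x = 1) (hQ1 : ∑ x, Q x = 1) (hne : ∃ x, Q x ≠ P x) :
    ∑ x, √(Q x) * √(P x) < 1 := by
  obtain ⟨y, hy⟩ := hne
  have hdist : 0 < ∑ x, (√(Q x) - √(P x)) ^ 2 := by
    refine Finset.sum_pos' (fun x _ => sq_nonneg _) ⟨y, Finset.mem_univ _, ?_⟩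
    exact sq_pos_of_ne_zero (sub_ne_zero.2 fun h => hy ((Real.sqrt_inj (hQ y) (hP y)).1 h))
  have hexpand : ∀ x, (√(Q x) - √(P x)) ^ 2 = Q x + P x - 2 * (√(Q x) * √(P x)) := fun x => by
    rw [sub_sq, Real.sq_sqrt (hQ x), Real.sq_sqrt (hP x)]
    ring
  simp only [hexpand, Finset.sum_sub_distrib, Finset.sum_add_distrib, ← Finset.mul_sum, hP1,
    hQ1] at hdist
  linarith

theorem exists_sum_sqrt_mul_sqrt_le {S : Set ℝ} (hS : IsCompact S)
    (hcont : ∀ x, ContinuousOn (p x) S) (hnn : ∀ t ∈ S, ∀ x, 0 ≤ p x t)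
    (hsum : ∀ t ∈ S, ∑ x, p x t = 1) {P : X → ℝ} (hP : ∀ x, 0 ≤ P x) (hP1 : ∑ x, P x = 1)
    (hne : ∀ t ∈ S, ∃ x, p x t ≠ P x) :
    ∃ κ < 1, ∀ t ∈ S, ∑ x, √(p x t) * √(P x) ≤ κ := by
  rcases S.eq_empty_or_nonempty with rfl | hSne
  · exact ⟨0, one_pos, by simp⟩
  have hc : ContinuousOn (fun t => ∑ x, √(p x t) * √(P x)) S :=
    continuousOn_finsetSum _ fun x _ => (hcont x).sqrt.mul continuousOn_const
  obtain ⟨t₀, ht₀, hmax⟩ := hS.exists_isMaxOn hSne hc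
  exact ⟨_, sum_sqrt_mul_sqrt_lt_one hP (hnn t₀ ht₀) hP1 (hsum t₀ ht₀) (hne t₀ ht₀),
    fun t ht => hmax ht⟩

theorem sum_sqrt_div_sqrt_le {P Q : X → ℝ} (hP : ∀ x, 0 < P x) (hQ : ∀ x, 0 ≤ Q x)
    (hQ1 : ∑ x, Q x = 1) {m : ℕ} {x : Fin m → X} {η : ℝ} (hx : ∀ z, |empDev P m x z| ≤ η) :
    ∑ r, √(Q (x r)) / √(P (x r)) ≤
      m * (∑ z, √(Q z) * √(P z) + η * ∑ z, (√(P z))⁻¹) := by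
  have hsqrt : ∀ z, 0 < √(P z) := fun z => Real.sqrt_pos.2 (hP z)
  have hmean : ∑ z, P z * (√(Q z) / √(P z)) = ∑ z, √(Q z) * √(P z) :=
    Finset.sum_congr rfl fun z _ => by
      nth_rw 1 [← Real.mul_self_sqrt (hP z).le]
      field_simp [(hsqrt z).ne']
  have hratio : ∀ z, √(Q z) / √(P z) ≤ (√(P z))⁻¹ := fun z => by
    rw [div_eq_mul_inv]
    refine mul_le_of_le_one_left (inv_nonneg.2 (hsqrt z).le) (Real.sqrt_le_one.2 ?_)
    exact hQ1 ▸ Finset.single_le_sum (fun y _ => hQ y) (Finset.mem_univ z)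
  have hdev := sum_sub_mean_eq_mul_sum_empDev P m x fun z => √(Q z) / √(P z)
  rw [Finset.sum_sub_distrib, hmean, Finset.sum_const, Finset.card_univ, Fintype.card_fin,
    nsmul_eq_mul, sub_eq_iff_eq_add'] at hdev
  rw [hdev, ← mul_add, Finset.mul_sum]
  refine mul_le_mul_of_nonneg_left (add_le_add_right (Finset.sum_le_sum fun z _ => ?_) _)
    m.cast_nonneg
  exact mul_le_mul ((le_abs_self _).trans (hx z)) (hratio z) (by positivity)
    ((abs_nonneg _).trans (hx z))

theorem exists_jointProb_lt_of_empDev_le {S : Set ℝ} (hS : IsCompact S)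
    (hcont : ∀ x, ContinuousOn (p x) S) (hnn : ∀ t ∈ S, ∀ x, 0 ≤ p x t)
    (hsum : ∀ t ∈ S, ∑ x, p x t = 1) {θ₀ : ℝ} (hpos : ∀ x, 0 < p x θ₀)
    (hsum₀ : ∑ x, p x θ₀ = 1) (hne : ∀ t ∈ S, ∃ x, p x t ≠ p x θ₀) :
    ∃ η > 0, ∀ m ≠ 0, ∀ x : Fin m → X, (∀ z, |empDev (fun a => p a θ₀) m x z| ≤ η) →
      ∀ t ∈ S, jointProb p m x t < jointProb p m x θ₀ := by
  obtain ⟨κ, hκ1, hκ⟩ := exists_sum_sqrt_mul_sqrt_le hS hcont hnn hsum (fun x => (hpos x).le)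
    hsum₀ hne
  set A := ∑ x, (√(p x θ₀))⁻¹
  obtain ⟨η, hη, hηA⟩ : ∃ η > 0, η * A < 1 - κ :=
    (((continuous_mul_const A).tendsto' 0 0 (zero_mul A)).eventually_lt_const
      (sub_pos.2 hκ1)).exists_gt
  refine ⟨η, hη, fun m hm x hx t ht => jointProb_lt_of_sum_sqrt_lt (hnn t ht) hpos ?_⟩
  calc ∑ r, √(p (x r) t) / √(p (x r) θ₀)
      ≤ m * (∑ z, √(p z t) * √(p z θ₀) + η * A) :=
        sum_sqrt_div_sqrt_le hpos (hnn t ht) (hsum t ht) hx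
    _ < m * 1 := by
        gcongr
        linarith [hκ t ht]
    _ = m := mul_one _

theorem IsMLE.exists_mem_of_empDev_le {K : Set ℝ} {est : EstimatorSeq X} (hest : IsMLE p K est)
    (hK : IsCompact K) (hcont : ∀ x, ContinuousOn (p x) K) (hnn : ∀ t ∈ K, ∀ x, 0 ≤ p x t)
    (hsum : ∀ t ∈ K, ∑ x, p x t = 1) {θ₀ : ℝ} (hθ : θ₀ ∈ K) (hpos : ∀ x, 0 < p x θ₀)
    (hne : ∀ t ∈ K, t ≠ θ₀ → ∃ x, p x t ≠ p x θ₀)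
    {U : Set ℝ} (hU : U ∈ 𝓝[K] θ₀) :
    ∃ η > 0, ∀ m ≠ 0, ∀ x : Fin m → X, (∀ z, |empDev (fun a => p a θ₀) m x z| ≤ η) →
      est m x ∈ U := by
  obtain ⟨V, hV, hθV, hVU⟩ := mem_nhdsWithin.1 hU
  obtain ⟨η, hη, hlt⟩ := exists_jointProb_lt_of_empDev_le (hK.diff hV)
    (fun x => (hcont x).mono Set.sdiff_subset) (fun t ht => hnn t ht.1) (fun t ht => hsum t ht.1)
    hpos (hsum θ₀ hθ) fun t ht => hne t ht.1 fun h => ht.2 (h ▸ hθV)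
  refine ⟨η, hη, fun m hm x hx => ?_⟩
  obtain ⟨hmem, hmax⟩ := hest m x
  by_contra hest_notMem
  exact (hmax θ₀ hθ).not_gt (hlt m hm x hx _ ⟨hmem, fun h => hest_notMem (hVU ⟨h, hmem⟩)⟩)

/-- The Fisher information at `t` with one of the two derivatives replaced by the difference
quotient between `θ₀` and `t`. The likelihood equation at `t` is linear in `t - θ₀` with this
coefficient. -/
noncomputable def slopeInfo (p : X → ℝ → ℝ) (θ₀ t : ℝ) : ℝ :=
  ∑ z, dslope (p z) θ₀ t * logDeriv (p z) t

theorem slopeInfo_self (p : X → ℝ → ℝ) (θ₀ : ℝ) : slopeInfo p θ₀ θ₀ = fisherInfo p θ₀ := by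
  simp only [slopeInfo, fisherInfo, dslope_same, logDeriv_apply, sq, mul_div_assoc]

theorem sum_mul_logDeriv {t : ℝ} (hp : ∀ x, p x t ≠ 0) :
    ∑ x, p x t * logDeriv (p x) t = ∑ x, deriv (p x) t :=
  Finset.sum_congr rfl fun x _ => mul_div_cancel₀ _ (hp x)

theorem sum_mul_logDeriv_sq {t : ℝ} (hp : ∀ x, p x t ≠ 0) :
    ∑ x, p x t * logDeriv (p x) t ^ 2 = fisherInfo p t := by
  refine Finset.sum_congr rfl fun x _ => ?_
  have := hp x
  rw [logDeriv_apply]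
  field_simp

theorem sub_mul_slopeInfo_of_isLocalMax {t : ℝ} (hp : ∀ x, p x t ≠ 0)
    (hdiff : ∀ x, DifferentiableAt ℝ (p x) t) (hderiv : ∑ x, deriv (p x) t = 0) {m : ℕ}
    (hm : m ≠ 0) {x : Fin m → X} (hmax : IsLocalMax (jointProb p m x) t) (θ₀ : ℝ) :
    (t - θ₀) * slopeInfo p θ₀ t =
      ∑ z, empDev (fun a => p a θ₀) m x z * logDeriv (p z) t := by
  have hscore : ∑ r, logDeriv (p (x r)) t = 0 := by
    have hzero := hmax.hasDerivAt_eq_zero (hasDerivAt_jointProb hp hdiff m x)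
    exact (mul_eq_zero.1 hzero).resolve_left (Finset.prod_ne_zero_iff.2 fun r _ => hp (x r))
  have hslope : (t - θ₀) * slopeInfo p θ₀ t = -∑ z, p z θ₀ * logDeriv (p z) t := by
    have hterm : ∀ z, (t - θ₀) * (dslope (p z) θ₀ t * logDeriv (p z) t) =
        p z t * logDeriv (p z) t - p z θ₀ * logDeriv (p z) t := fun z => by
      rw [← mul_assoc, ← smul_eq_mul (t - θ₀), sub_smul_dslope, sub_mul]
    simp only [slopeInfo, Finset.mul_sum, hterm, Finset.sum_sub_distrib, sum_mul_logDeriv hp,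
      hderiv, zero_sub]
  have hdev := sum_sub_mean_eq_mul_sum_empDev (fun a => p a θ₀) m x fun z => logDeriv (p z) t
  rw [Finset.sum_sub_distrib, hscore, Finset.sum_const, Finset.card_univ, Fintype.card_fin,
    nsmul_eq_mul, zero_sub, ← mul_neg] at hdev
  exact hslope.trans (mul_left_cancel₀ (Nat.cast_ne_zero.2 hm) hdev)

theorem continuousAt_logDeriv {f : ℝ → ℝ} {t : ℝ} (hf : ContDiffAt ℝ 1 f t) (h0 : f t ≠ 0) :
    ContinuousAt (logDeriv f) t := by
  refine ContinuousAt.div ?_ hf.continuousAt h0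
  simpa only [fderiv_apply_one_eq_deriv] using
    (hf.continuousAt_fderiv one_ne_zero).clm_apply (continuousAt_const (y := (1 : ℝ)))

theorem continuousAt_slopeInfo {θ₀ : ℝ} (hC1 : ∀ x, ContDiffAt ℝ 1 (p x) θ₀)
    (hp : ∀ x, p x θ₀ ≠ 0) : ContinuousAt (slopeInfo p θ₀) θ₀ :=
  tendsto_finsetSum _ fun z _ =>
    (continuousAt_dslope_same.2 ((hC1 z).differentiableAt one_ne_zero)).mul
      (continuousAt_logDeriv (hC1 z) (hp z))

theorem abs_sum_mul_sub_sum_mul_le {ι : Type*} (s : Finset ι) (d : ι → ℝ) {a b : ι → ℝ} {ε : ℝ}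
    (h : ∀ z ∈ s, |a z - b z| ≤ ε) :
    |∑ z ∈ s, d z * a z - ∑ z ∈ s, d z * b z| ≤ ε * ∑ z ∈ s, |d z| := by
  rw [← Finset.sum_sub_distrib, Finset.mul_sum]
  refine (Finset.abs_sum_le_sum_abs _ _).trans (Finset.sum_le_sum fun z hz => ?_)
  rw [← mul_sub, abs_mul, mul_comm]
  exact mul_le_mul_of_nonneg_right (h z hz) (abs_nonneg _)

theorem eventually_expansion_of_isLocalMax {θ₀ c : ℝ} (hsum : ∀ᶠ s in 𝓝 θ₀, ∑ x, p x s = c)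
    (hp : ∀ x, p x θ₀ ≠ 0) (hC1 : ∀ x, ContDiffAt ℝ 1 (p x) θ₀) (hF : fisherInfo p θ₀ ≠ 0)
    {ε : ℝ} (hε : 0 < ε) :
    ∀ᶠ t in 𝓝 θ₀, ∀ m ≠ 0, ∀ x : Fin m → X, IsLocalMax (jointProb p m x) t →
      |t - (θ₀ + ∑ z, empDev (fun a => p a θ₀) m x z * (logDeriv (p z) θ₀ / fisherInfo p θ₀))| ≤
        ε * ∑ z, |empDev (fun a => p a θ₀) m x z| := by
  have hslope := continuousAt_slopeInfo hC1 hp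
  rw [← slopeInfo_self] at hF ⊢
  have hclose : ∀ᶠ t in 𝓝 θ₀, ∀ z,
      |logDeriv (p z) t / slopeInfo p θ₀ t - logDeriv (p z) θ₀ / slopeInfo p θ₀ θ₀| ≤ ε :=
    eventually_all.2 fun z => ((continuousAt_logDeriv (hC1 z) (hp z)).div hslope hF).eventually
      (Metric.closedBall_mem_nhds _ hε)
  have hnear : ∀ᶠ t in 𝓝 θ₀, ∀ x, p x t ≠ 0 ∧ DifferentiableAt ℝ (p x) t :=
    eventually_all.2 fun x => ((hC1 x).continuousAt.eventually_ne (hp x)).and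
      (((hC1 x).eventually (by simp)).mono fun t ht => ht.differentiableAt one_ne_zero)
  filter_upwards [hclose, hnear, hslope.eventually_ne hF, eventually_eventually_nhds.2 hsum]
    with t hquot hpt hslope_ne hsum_t m hm x hmax
  have heq := sub_mul_slopeInfo_of_isLocalMax (fun x => (hpt x).1) (fun x => (hpt x).2)
    (sum_deriv_eq_zero hsum_t fun x => (hpt x).2) hm hmax θ₀
  have hsolved : t - θ₀ = ∑ z, empDev (fun a => p a θ₀) m x z *
      (logDeriv (p z) t / slopeInfo p θ₀ t) := by
    simp only [← mul_div_assoc, ← Finset.sum_div]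
    exact eq_div_of_mul_eq hslope_ne heq
  rw [← sub_sub, hsolved]
  exact abs_sum_mul_sub_sum_mul_le _ _ fun z _ => hquot z

namespace IsMLE

variable {K : Set ℝ} {θ₀ : ℝ} {est : EstimatorSeq X}

theorem isAsymptoticallyLinear (hest : IsMLE p K est) (hK : IsCompact K)
    (hcont : ∀ x, ContinuousOn (p x) K) (hnn : ∀ t ∈ K, ∀ x, 0 ≤ p x t)
    (hsum : ∀ t ∈ K, ∑ x, p x t = 1) (hθ : θ₀ ∈ interior K) (hpos : ∀ x, 0 < p x θ₀)
    (hC1 : ∀ x, ContDiffAt ℝ 1 (p x) θ₀) (hne : ∀ t ∈ K, t ≠ θ₀ → ∃ x, p x t ≠ p x θ₀)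
    (hF : fisherInfo p θ₀ ≠ 0) :
    IsAsymptoticallyLinear (fun x => p x θ₀) θ₀
      (fun x => logDeriv (p x) θ₀ / fisherInfo p θ₀) est := by
  have hθK : θ₀ ∈ K := interior_subset hθ
  have hp : ∀ x, p x θ₀ ≠ 0 := fun x => (hpos x).ne'
  have hsum_nhds : ∀ᶠ s in 𝓝 θ₀, ∑ x, p x s = 1 := by
    filter_upwards [mem_interior_iff_mem_nhds.1 hθ] with s hs using hsum s hs
  have hcentered : ∑ x, p x θ₀ * (logDeriv (p x) θ₀ / fisherInfo p θ₀) = 0 := by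
    simp only [← mul_div_assoc, ← Finset.sum_div]
    rw [sum_mul_logDeriv hp, sum_deriv_eq_zero hsum_nhds
      fun x => (hC1 x).differentiableAt one_ne_zero, zero_div]
  obtain ⟨D, hD⟩ := hK.isBounded.exists_norm_le
  refine isAsymptoticallyLinear_of_empDev (fun x => (hpos x).le) (hsum θ₀ hθK) hcentered
    (fun m x => hD _ (hest m x).1) fun ε hε => ?_
  have hexpansion := (eventually_expansion_of_isLocalMax hsum_nhds hp hC1 hF hε).and
    (isOpen_interior.mem_nhds hθ)
  obtain ⟨η, hη, hmem⟩ := hest.exists_mem_of_empDev_le hK hcont hnn hsum hθK hpos hne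
    (mem_nhdsWithin_of_mem_nhds hexpansion)
  refine ⟨η, hη, fun m hm x hx => ?_⟩
  obtain ⟨hlinear, hint⟩ := hmem m hm x hx
  refine hlinear m hm x ?_
  filter_upwards [mem_interior_iff_mem_nhds.1 hint] with s hs using (hest m x).2 s hs

theorem isAsymptoticallyLinear_zero_of_finite {S : Set ℝ} (hest : IsMLE p S est) (hS : S.Finite)
    (hnn : ∀ t ∈ S, ∀ x, 0 ≤ p x t) (hsum : ∀ t ∈ S, ∑ x, p x t = 1) (hθ : θ₀ ∈ S)
    (hpos : ∀ x, 0 < p x θ₀) (hne : ∀ t ∈ S, t ≠ θ₀ → ∃ x, p x t ≠ p x θ₀) :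
    IsAsymptoticallyLinear (fun x => p x θ₀) θ₀ 0 est := by
  obtain ⟨D, hD⟩ := hS.isBounded.exists_norm_le
  have hisolated : {θ₀} ∈ 𝓝[S] θ₀ := by
    rw [hS.isDiscrete.nhdsWithin θ₀ hθ]
    exact Set.mem_singleton θ₀
  obtain ⟨η, hη, hmem⟩ := hest.exists_mem_of_empDev_le hS.isCompact (fun x => hS.continuousOn _)
    hnn hsum hθ hpos hne hisolated
  refine isAsymptoticallyLinear_of_empDev (fun x => (hpos x).le) (hsum θ₀ hθ) (by simp)
    (fun m x => hD _ (hest m x).1) fun ε hε => ⟨η, hη, fun m hm x hx => ?_⟩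
  rw [Set.mem_singleton_iff.1 (hmem m hm x hx)]
  simpa using mul_nonneg hε.le (Finset.sum_nonneg fun z _ => abs_nonneg _)

end IsMLE

end MaximumLikelihood

/-! ### Saturation of the bounds -/

section Saturation

variable {X : Type*} [Fintype X] {n : ℕ} {p : X → ℝ → ℝ} {θ : Fin n → ℝ} {w : Fin n → ℝ}
  {est : EstimatorSeq X}

theorem tendsto_mul_varRep {v : Fin n → ℝ}
    (h : ∀ i, Tendsto (fun m : ℕ => m * iidVar (fun a => p a (θ i)) m (est m)) atTop (𝓝 (v i))) :
    Tendsto (fun m : ℕ => m * varRep w p θ est m) atTop (𝓝 (∑ i, w i * v i)) := by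
  refine (tendsto_finsetSum Finset.univ fun i _ => (h i).const_mul (w i)).congr fun m => ?_
  simp only [mul_left_comm (w _), ← Finset.mul_sum]
  rfl

theorem isEquivalent_of_tendsto_mul {u v : ℕ → ℝ} {L : ℝ} (hL : L ≠ 0)
    (hu : Tendsto (fun m : ℕ => m * u m) atTop (𝓝 L))
    (hv : Tendsto (fun m : ℕ => m * v m) atTop (𝓝 L)) : u ~[atTop] v := by
  have hmul := ((isEquivalent_const_iff_tendsto hL).2 hu).trans
    ((isEquivalent_const_iff_tendsto hL).2 hv).symm
  refine isLittleO_of_natCast_mul (hmul.isLittleO.congr_left fun m => ?_)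
  simp only [Pi.sub_apply, mul_sub]

theorem biasRep_self_eq_iidSum (hpos : ∀ i x, 0 < p x (θ i))
    (hdiff : ∀ i x, DifferentiableAt ℝ (p x) (θ i)) {i : Fin n}
    (hderiv : ∑ x, deriv (p x) (θ i) = 0) (m : ℕ) :
    biasRep p θ est i i m = iidSum (fun a => p a (θ i)) m fun x =>
      (∑ r, logDeriv (p (x r)) (θ i)) * est m x := by
  rw [biasRep_eq_sum_mul hpos hdiff hderiv, score_m_eq_tensorScore hpos hdiff]
  exact Finset.sum_congr rfl fun x _ => mul_assoc _ _ _

section Smooth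

variable {K : Set ℝ} (hest : IsMLE p K est) (hK : IsCompact K)
  (hcont : ∀ x, ContinuousOn (p x) K) (hnn : ∀ t ∈ K, ∀ x, 0 ≤ p x t)
  (hsum : ∀ t ∈ K, ∑ x, p x t = 1) (hθ : ∀ i, θ i ∈ interior K) (hpos : ∀ i x, 0 < p x (θ i))
  (hderiv : ∀ i, ∑ x, deriv (p x) (θ i) = 0) (hC1 : ∀ i x, ContDiffAt ℝ 1 (p x) (θ i))
  (hne : ∀ i, ∀ t ∈ K, t ≠ θ i → ∃ x, p x t ≠ p x (θ i)) (hF : ∀ i, fisherInfo p (θ i) ≠ 0)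

include hest hK hcont hnn hsum hθ hpos hderiv hC1 hne hF

theorem IsMLE.tendsto_mul_varRep :
    Tendsto (fun m : ℕ => m * varRep w p θ est m) atTop
      (𝓝 (∑ i, w i / fisherInfo p (θ i))) := by
  have hvariance : ∀ i, ∑ x, p x (θ i) * (logDeriv (p x) (θ i) / fisherInfo p (θ i)) ^ 2 =
      (fisherInfo p (θ i))⁻¹ := fun i => by
    simp only [div_pow, ← mul_div_assoc, ← Finset.sum_div]
    rw [sum_mul_logDeriv_sq fun x => (hpos i x).ne', sq, div_self_mul_self']
  have hcentered : ∀ i, ∑ x, p x (θ i) * (logDeriv (p x) (θ i) / fisherInfo p (θ i)) = 0 :=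
    fun i => by
      simp only [← mul_div_assoc, ← Finset.sum_div]
      rw [sum_mul_logDeriv fun x => (hpos i x).ne', hderiv, zero_div]
  refine _root_.tendsto_mul_varRep fun i => ?_
  rw [← hvariance]
  exact (hest.isAsymptoticallyLinear hK hcont hnn hsum (hθ i) (hpos i) (hC1 i) (hne i)
    (hF i)).tendsto_mul_iidVar (fun x => (hpos i x).le) (hsum _ (interior_subset (hθ i)))
    (hcentered i)

theorem IsMLE.tendsto_biasRep_self (i : Fin n) : Tendsto (biasRep p θ est i i) atTop (𝓝 1) := by
  have hdiff : ∀ i x, DifferentiableAt ℝ (p x) (θ i) := fun i x =>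
    (hC1 i x).differentiableAt one_ne_zero
  have hp : ∀ x, p x (θ i) ≠ 0 := fun x => (hpos i x).ne'
  have hcovariance : ∑ x, p x (θ i) * (logDeriv (p x) (θ i) *
      (logDeriv (p x) (θ i) / fisherInfo p (θ i))) = 1 := by
    simp only [← mul_div_assoc, ← Finset.sum_div, ← sq]
    rw [sum_mul_logDeriv_sq hp, div_self (hF i)]
  rw [← hcovariance]
  refine ((hest.isAsymptoticallyLinear hK hcont hnn hsum (hθ i) (hpos i) (hC1 i) (hne i)
    (hF i)).tendsto_iidSum_sum_mul (fun x => (hpos i x).le) (hsum _ (interior_subset (hθ i)))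
    ((sum_mul_logDeriv hp).trans (hderiv i))).congr fun m => ?_
  rw [biasRep_self_eq_iidSum hpos hdiff (hderiv i)]

theorem IsMLE.tendsto_mul_gcrRep :
    Tendsto (fun m : ℕ => m * gcrRep w p θ est m) atTop
      (𝓝 (∑ i, w i / fisherInfo p (θ i))) := by
  have hdiff : ∀ i x, DifferentiableAt ℝ (p x) (θ i) := fun i x =>
    (hC1 i x).differentiableAt one_ne_zero
  have hlim := tendsto_finsetSum Finset.univ fun i _ =>
    (((hest.tendsto_biasRep_self hK hcont hnn hsum hθ hpos hderiv hC1 hne hF i).pow 2).div_const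
      (fisherInfo p (θ i))).const_mul (w i)
  simp only [one_pow, mul_one_div] at hlim
  refine hlim.congr' ?_
  filter_upwards [eventually_ne_atTop 0] with m hm
  exact (mul_gcrRep hpos hdiff (fun i => hsum _ (interior_subset (hθ i))) hderiv w est hm).symm

theorem IsMLE.varRep_isEquivalent (hw : ∀ i, 0 ≤ w i) (hL : ∑ i, w i / fisherInfo p (θ i) ≠ 0) :
    varRep w p θ est ~[atTop] gcrRep w p θ est ∧ varRep w p θ est ~[atTop] fgRep w p θ est := by
  have hvar := hest.tendsto_mul_varRep (w := w) hK hcont hnn hsum hθ hpos hderiv hC1 hne hF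
  have hgcr := hest.tendsto_mul_gcrRep (w := w) hK hcont hnn hsum hθ hpos hderiv hC1 hne hF
  have hfg : Tendsto (fun m : ℕ => m * fgRep w p θ est m) atTop
      (𝓝 (∑ i, w i / fisherInfo p (θ i))) :=
    tendsto_of_tendsto_of_tendsto_of_le_of_le hgcr hvar
      (fun m => mul_le_mul_of_nonneg_left
        (globalCRBound_le_fullyGlobalBound _ _ hw (dist_m_pos hpos m)) m.cast_nonneg)
      (fun m => mul_le_mul_of_nonneg_left
        (fullyGlobalBound_le_weightedVar _ _ hw (dist_m_pos hpos m)) m.cast_nonneg)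
  exact ⟨isEquivalent_of_tendsto_mul hL hvar hgcr, isEquivalent_of_tendsto_mul hL hvar hfg⟩

end Smooth

theorem sum_div_fisherInfo_pos (hw : ∀ i, 0 ≤ w i) (hw1 : ∑ i, w i = 1)
    (hF : ∀ i, 0 < fisherInfo p (θ i)) : 0 < ∑ i, w i / fisherInfo p (θ i) := by
  obtain ⟨i, hi, hwi⟩ := Finset.exists_ne_zero_of_sum_ne_zero (hw1.trans_ne one_ne_zero)
  exact Finset.sum_pos' (fun i _ => div_nonneg (hw i) (hF i).le)
    ⟨i, hi, div_pos ((hw i).lt_of_ne' hwi) (hF i)⟩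

theorem IsMLE.tendsto_mul_varRep_range (hest : IsMLE p (Set.range θ) est)
    (hpos : ∀ i x, 0 < p x (θ i)) (hsum : ∀ i, ∑ x, p x (θ i) = 1)
    (hne : ∀ i j, (∀ x, p x (θ j) = p x (θ i)) → θ j = θ i) :
    Tendsto (fun m : ℕ => m * varRep w p θ est m) atTop (𝓝 0) := by
  rw [← Finset.sum_eq_zero fun i _ => mul_zero (w i)]
  refine _root_.tendsto_mul_varRep fun i => ?_
  have hlinear : IsAsymptoticallyLinear (fun x => p x (θ i)) (θ i) 0 est := by
    refine hest.isAsymptoticallyLinear_zero_of_finite (Set.finite_range θ) ?_ ?_ ⟨i, rfl⟩ (hpos i)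
      ?_
    · rintro _ ⟨j, rfl⟩ x
      exact (hpos j x).le
    · rintro _ ⟨j, rfl⟩
      exact hsum j
    · rintro _ ⟨j, rfl⟩ hji
      by_contra! heq
      exact hji (hne i j heq)
  simpa using hlinear.tendsto_mul_iidVar (fun x => (hpos i x).le) (hsum i) (by simp)

theorem tendsto_mul_varRep_sub_of_tendsto_zero (hpos : ∀ i x, 0 < p x (θ i)) (hw : ∀ i, 0 ≤ w i)
    (hvar : Tendsto (fun m : ℕ => m * varRep w p θ est m) atTop (𝓝 0)) :
    Tendsto (fun m : ℕ => (m : ℝ) * (varRep w p θ est m - gcrRep w p θ est m)) atTop (𝓝 0) ∧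
      Tendsto (fun m : ℕ => (m : ℝ) * (varRep w p θ est m - fgRep w p θ est m)) atTop (𝓝 0) := by
  have hnonneg : ∀ m, 0 ≤ gcrRep w p θ est m := fun m =>
    globalCRBound_nonneg _ _ hw (dist_m_pos hpos m)
  have hgcr : ∀ m, gcrRep w p θ est m ≤ fgRep w p θ est m := fun m =>
    globalCRBound_le_fullyGlobalBound _ _ hw (dist_m_pos hpos m)
  have hfg : ∀ m, fgRep w p θ est m ≤ varRep w p θ est m := fun m =>
    fullyGlobalBound_le_weightedVar _ _ hw (dist_m_pos hpos m)
  constructor <;>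
    refine squeeze_zero (fun m => mul_nonneg m.cast_nonneg ?_)
      (fun m => mul_le_mul_of_nonneg_left ?_ m.cast_nonneg) hvar <;>
    linarith [hnonneg m, hgcr m, hfg m]

end Saturation

theorem mainTheorem4 {X : Type*} [Fintype X] {n : ℕ}
    -- the model `p x t = p(x|t)` on a parameter domain `K`, and the values `θ i`
    (p : X → ℝ → ℝ) (K : Set ℝ)
    (hnonneg : ∀ t ∈ K, ∀ x, 0 ≤ p x t) (hsum : ∀ t ∈ K, ∑ x, p x t = 1)
    (θ : Fin n → ℝ) (hθ : ∀ i, θ i ∈ interior K)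
    (hpos : ∀ i x, 0 < p x (θ i)) (hdiff : ∀ i x, DifferentiableAt ℝ (p x) (θ i))
    (w : Fin n → ℝ) (hw : ∀ i, 0 ≤ w i) (hw1 : ∑ i, w i = 1) :
    -- the two bounds are the optimal values over all, resp. all diagonal, hierarchy matrices,
    -- and they bound the weighted variance
    (∀ (est : EstimatorSeq X) (m : ℕ),
      IsLUB (Set.range fun A : Matrix (Fin n) (Fin n) ℝ =>
        scoreBound w (dist_m p θ m) (score_m p θ m) (est m) A) (fgRep w p θ est m) ∧
      IsLUB (Set.range fun a : Fin n → ℝ =>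
        scoreBound w (dist_m p θ m) (score_m p θ m) (est m) (Matrix.diagonal a))
        (gcrRep w p θ est m) ∧
      gcrRep w p θ est m ≤ fgRep w p θ est m ∧ fgRep w p θ est m ≤ varRep w p θ est m) ∧
    -- the chi-square overlap of two distributions
    (∀ P Q : X → ℝ, (∀ x, 0 ≤ P x) → (∀ x, 0 ≤ Q x) → ∑ x, P x = 1 → ∑ x, Q x = 1 →
      (∀ x, 0 < Q x → 0 < P x) →
      1 ≤ ∑ x, Q x ^ 2 / P x ∧ (∑ x, Q x ^ 2 / P x = 1 ↔ Q = P)) ∧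
    -- the limiting form of a block pseudoinverse
    (∀ (k : ℕ) (D : ℕ → Matrix (Fin k) (Fin k) ℝ) (v : ℕ → Fin k → ℝ) (c : ℕ → ℝ),
      (∀ m, (D m).IsSymm) → (∀ m, ∃ u, D m *ᵥ u = v m) →
      Tendsto (fun m => pinv (D m)) atTop (𝓝 0) →
      (∃ B, ∀ m j, |v m j| ≤ B) → (∃ ε > 0, ∀ m, ε ≤ |c m|) →
      Tendsto (fun m =>
        pinv (Matrix.fromBlocks (D m) (Matrix.replicateCol Unit (v m))
          (Matrix.replicateRow Unit (v m)) (Matrix.of fun _ _ => c m)) -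
        Matrix.fromBlocks 0 0 0 (Matrix.of fun _ _ => 1 / c m)) atTop (𝓝 0)) ∧
    -- the exact formula for the information matrix of `m` repetitions
    (∀ (m : ℕ) (i j k : Fin n), infoRep p θ i m j k =
      (m : ℝ) * ((m : ℝ) - 1) * lam p θ i j k ^ (m - 2) * (rCoef p θ i j k * rCoef p θ i k j) +
        (m : ℝ) * lam p θ i j k ^ (m - 1) * infoRep p θ i 1 j k) ∧
    (∀ i j k : Fin n,
      infoRep p θ i 1 j k = ∑ x, deriv (p x) (θ j) * deriv (p x) (θ k) / p x (θ i)) ∧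
    -- the limit of the pseudoinverse of the normalized information matrix
    (∀ i : Fin n, (∀ j, j ≠ i → ∃ x, p x (θ j) ≠ p x (θ i)) →
      Tendsto (fun m : ℕ => pinv ((m : ℝ)⁻¹ • infoRep p θ i m)) atTop
        (𝓝 (Matrix.single i i (1 / infoRep p θ i 1 i i)))) ∧
    -- asymptotic equality of the two bounds
    ((∀ i j, (∀ x, p x (θ j) = p x (θ i)) →
        ∃ r : ℝ, ∀ x, deriv (p x) (θ j) = r * deriv (p x) (θ i)) →
      ∀ est : EstimatorSeq X,
        ((∀ j, w j = 0 → (fun m => biasRep p θ est j j m ^ 2) =O[atTop]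
            fun m => ∑ i, w i * biasRep p θ est i i m ^ 2) →
          fgRep w p θ est ~[atTop] gcrRep w p θ est) ∧
        ((∀ j, biasRep p θ est j j =O[atTop] fun _ => (1 : ℝ)) →
          Tendsto (fun m : ℕ => (m : ℝ) * (fgRep w p θ est m - gcrRep w p θ est m))
            atTop (𝓝 0))) ∧
    -- saturation by the maximum-likelihood estimator over a compact parameter domain
    (IsCompact K → (∀ x, ContinuousOn (p x) K) → (∀ i x, ContDiffAt ℝ 1 (p x) (θ i)) →
      (∀ i, ∀ t ∈ K, t ≠ θ i → ∃ x, p x t ≠ p x (θ i)) → (∀ i, 0 < fisherInfo p (θ i)) →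
      ∀ est : EstimatorSeq X, IsMLE p K est →
        varRep w p θ est ~[atTop] gcrRep w p θ est ∧
        varRep w p θ est ~[atTop] fgRep w p θ est ∧
        Tendsto (fun m : ℕ => (m : ℝ) * varRep w p θ est m) atTop
          (𝓝 (∑ i, w i / fisherInfo p (θ i)))) ∧
    -- saturation, on the scale `1 / m`, by the maximum-likelihood estimator over the finite set
    ((∀ i j, (∀ x, p x (θ j) = p x (θ i)) → θ j = θ i) →
      ∀ est : EstimatorSeq X, IsMLE p (Set.range θ) est →
        Tendsto (fun m : ℕ => (m : ℝ) * (varRep w p θ est m - gcrRep w p θ est m))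
          atTop (𝓝 0) ∧
        Tendsto (fun m : ℕ => (m : ℝ) * (varRep w p θ est m - fgRep w p θ est m))
          atTop (𝓝 0)) := by
  have hsumθ : ∀ i, ∑ x, p x (θ i) = 1 := fun i => hsum _ (interior_subset (hθ i))
  have hderiv : ∀ i, ∑ x, deriv (p x) (θ i) = 0 := fun i => by
    refine sum_deriv_eq_zero (c := 1) ?_ (hdiff i)
    filter_upwards [mem_interior_iff_mem_nhds.1 (hθ i)] with s hs using hsum s hs
  have hchisq : ∀ P Q : X → ℝ, (∀ x, 0 ≤ P x) → (∀ x, 0 ≤ Q x) → ∑ x, P x = 1 → ∑ x, Q x = 1 →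
      (∀ x, 0 < Q x → 0 < P x) → 1 ≤ ∑ x, Q x ^ 2 / P x ∧ (∑ x, Q x ^ 2 / P x = 1 ↔ Q = P) := by
    intro P Q hP hQ hP1 hQ1 hPQ
    have hsupp : ∀ x, P x = 0 → Q x = 0 := fun x hx =>
      ((hQ x).eq_of_not_lt fun h => (hPQ x h).ne' hx).symm
    exact ⟨one_le_sum_sq_div hP hP1 hQ1 hsupp, sum_sq_div_eq_one_iff hP hP1 hQ1 hsupp⟩
  refine ⟨fun est m => ⟨isLUB_fullyGlobalBound _ _ hw (dist_m_pos hpos m),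
      isLUB_globalCRBound _ _ hw (dist_m_pos hpos m),
      globalCRBound_le_fullyGlobalBound _ _ hw (dist_m_pos hpos m),
      fullyGlobalBound_le_weightedVar _ _ hw (dist_m_pos hpos m)⟩, hchisq,
    fun _ _ _ _ => tendsto_pinv_fromBlocks, infoRep_eq hpos hdiff, infoRep_one hpos hdiff,
    fun i => tendsto_pinv_infoRep hpos hdiff hsumθ hderiv,
    fun hcoll est => ⟨fgRep_isEquivalent_gcrRep hpos hdiff hsumθ hderiv hcoll hw est,
      tendsto_mul_fgRep_sub_gcrRep hpos hdiff hsumθ hderiv hcoll w est⟩,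
    fun hK hcont hC1 hne hF est hest => ?_,
    fun hne est hest => tendsto_mul_varRep_sub_of_tendsto_zero hpos hw
      (hest.tendsto_mul_varRep_range hpos hsumθ hne)⟩
  have hF' : ∀ i, fisherInfo p (θ i) ≠ 0 := fun i => (hF i).ne'
  obtain ⟨hgcr, hfg⟩ := hest.varRep_isEquivalent hK hcont hnonneg hsum hθ hpos hderiv hC1 hne hF'
    hw (sum_div_fisherInfo_pos hw hw1 hF).ne'
  exact ⟨hgcr, hfg, hest.tendsto_mul_varRep hK hcont hnonneg hsum hθ hpos hderiv hC1 hne hF'⟩
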